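/- Let $M,n\ge 1$ be integers, $\sigma\ge 0$, $R>0$, and $\mathbf f\in\mathbf R^n$. Observe $\mathbf y=\mathbf f+\boldsymbol\xi$ with $\boldsymbol\xi\sim\mathcal N(0,\sigma^2 I_{n\times n})$. For $j=1,\dots,M$ let $A_j$ be a deterministic real $n\times n$ matrix and $\boldsymbol b_j\in\mathbf R^n$ a deterministic vector, and let $\hat{\boldsymbol\mu}_j=A_j\mathbf y+\boldsymbol b_j$. Write $\|\cdot\|$ for the Euclidean norm and $\|\cdot\|_{op}$ for the associated operator norm, and assume $$\tfrac1n\|\mathbf f\|^2\le R^2,\qquad \tfrac1n\|\boldsymbol b_j\|^2\le R^2,\qquad \|A_j\|_{op}\le 1,\qquad j=1,\dots,M.$$ Let $\Lambda^M=\{\theta\in\mathbf R^M:\ \theta_j\ge0,\ \sum_j\theta_j=1\}$. For $\theta\in\mathbf R^M$ put $A_\theta=\sum_j\theta_jA_j$, $\boldsymbol b_\theta=\sum_j\theta_j\boldsymbol b_j$, $\hat{\boldsymbol\mu}_\theta=A_\theta\mathbf y+\boldsymbol b_\theta$, and $$C_p(\theta)=\|\hat{\boldsymbol\mu}_\theta\|^2-2\mathbf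 y^T\hat{\boldsymbol\mu}_\theta+2\sigma^2\operatorname{Tr}(A_\theta),\qquad H_{pen}(\theta)=C_p(\theta)+\tfrac12\sum_{j}\theta_j\|\hat{\boldsymbol\mu}_\theta-\hat{\boldsymbol\mu}_j\|^2 .$$ (i) Let $\hat\theta_C\in\operatorname{argmin}_{\theta\in\Lambda^M}C_p(\theta)$. Then for all $x>0$, with probability greater than $1-2e^{-x}$, $$\tfrac1n\|\hat{\boldsymbol\mu}_{\hat\theta_C}-\mathbf f\|^2\le\min_{\theta\in\Lambda^M}\tfrac1n\|\hat{\boldsymbol\mu}_\theta-\mathbf f\|^2+8(\sigma^2+\sqrt2\,\sigma R)\sqrt{\frac{x+2\log M}{n}}+\frac{8\sigma^2(x+2\log M)}{n}.$$ (ii) Let $m=\big\lfloor\sqrt{n/\log(1+M/\sqrt n)}\big\rfloor$ and, if $m\ge1$, let $$\Lambda^M_m=\Big\{\tfrac1m\sum_{q=1}^m\boldsymbol u_q:\ \boldsymbol u_1,\dots,\boldsymbol u_m\in\{\boldsymbol e_1,\dots,\boldsymbol e_M\}\Big\},$$ where $\boldsymbol e_1,\dots,\boldsymbol e_M$ is the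 canonical basis of $\mathbf R^M$. Let $\hat{\boldsymbol\mu}_{\Lambda^M_m}$ be the aggregate of the finite family of affine estimators $(\hat{\boldsymbol\mu}_{\boldsymbol u})_{\boldsymbol u\in\Lambda^M_m}$, whose matrices and vectors are $(A_{\boldsymbol u},\boldsymbol b_{\boldsymbol u})$, with weights that minimize over the simplex of dimension $|\Lambda^M_m|-1$ the criterion $H_{pen}$ formed from this family. There is an absolute constant $C>0$, independent of all the above quantities, such that if $M\le\sqrt n\,(e^n-1)$ (which ensures $m\ge1$), then for all $x>0$, with probability greater than $1-3e^{-x}$, $$\tfrac1n\|\hat{\boldsymbol\mu}_{\Lambda^M_m}-\mathbf f\|^2\le\min_{\theta\in\Lambda^M}\tfrac1n\|\hat{\boldsymbol\mu}_\theta-\mathbf f\|^2+C\max(R^2,\sigma^2)\sqrt{\frac{\log(1+M/\sqrt n)}{n}}+\frac{C\sigma^2x}{n}.$$ -/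

import Mathlib

open MeasureTheory ProbabilityTheory
open scoped Matrix.Norms.L2Operator

noncomputable section

namespace AffineAggregation

variable {n : ℕ} {ι : Type*} [Fintype ι]

/-- The affine estimator `A y + b`. -/
def affineEst (A : Matrix (Fin n) (Fin n) ℝ) (b y : EuclideanSpace ℝ (Fin n)) :
    EuclideanSpace ℝ (Fin n) :=
  Matrix.toEuclideanCLM (𝕜 := ℝ) A y + b

/-- `A_θ = ∑ j, θ_j A_j`. -/
def mixMatrix (A : ι → Matrix (Fin n) (Fin n) ℝ) (θ : ι → ℝ) : Matrix (Fin n) (Fin n) ℝ :=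
  ∑ j, θ j • A j

/-- `b_θ = ∑ j, θ_j b_j`. -/
def mixVector (b : ι → EuclideanSpace ℝ (Fin n)) (θ : ι → ℝ) : EuclideanSpace ℝ (Fin n) :=
  ∑ j, θ j • b j

/-- `μ_θ = A_θ y + b_θ`. -/
def mixEst (A : ι → Matrix (Fin n) (Fin n) ℝ) (b : ι → EuclideanSpace ℝ (Fin n))
    (y : EuclideanSpace ℝ (Fin n)) (θ : ι → ℝ) : EuclideanSpace ℝ (Fin n) :=
  affineEst (mixMatrix A θ) (mixVector b θ) y

/-- Mallows' criterion `C_p(θ) = ‖μ_θ‖² - 2 yᵀ μ_θ + 2 σ² Tr A_θ`. -/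
def Cp (σ : ℝ) (A : ι → Matrix (Fin n) (Fin n) ℝ) (b : ι → EuclideanSpace ℝ (Fin n))
    (y : EuclideanSpace ℝ (Fin n)) (θ : ι → ℝ) : ℝ :=
  ‖mixEst A b y θ‖ ^ 2 - 2 * inner ℝ y (mixEst A b y θ)
    + 2 * σ ^ 2 * (mixMatrix A θ).trace

/-- The penalty `pen(θ) = ∑ j, θ_j ‖μ_θ - μ_j‖²`. -/
def pen (A : ι → Matrix (Fin n) (Fin n) ℝ) (b : ι → EuclideanSpace ℝ (Fin n))
    (y : EuclideanSpace ℝ (Fin n)) (θ : ι → ℝ) : ℝ :=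
  ∑ j, θ j * ‖mixEst A b y θ - affineEst (A j) (b j) y‖ ^ 2

/-- The penalized criterion `H_pen = C_p + pen / 2`. -/
def Hpen (σ : ℝ) (A : ι → Matrix (Fin n) (Fin n) ℝ) (b : ι → EuclideanSpace ℝ (Fin n))
    (y : EuclideanSpace ℝ (Fin n)) (θ : ι → ℝ) : ℝ :=
  Cp σ A b y θ + 1 / 2 * pen A b y θ

/-- `θ ∈ argmin_{θ' ∈ simplex} F(θ')`. -/
def IsSimplexArgmin (F : (ι → ℝ) → ℝ) (θ : ι → ℝ) : Prop :=
  θ ∈ stdSimplex ℝ ι ∧ IsMinOn F (stdSimplex ℝ ι) θ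

/-- `m = ⌊√(n / log (1 + M / √n))⌋`. -/
def gridSize (n M : ℕ) : ℕ :=
  ⌊√((n : ℝ) / Real.log (1 + (M : ℝ) / √(n : ℝ)))⌋₊

/-- The set of all averages `(1/m) ∑ q, u_q` of `m` vectors `u_q` of the canonical basis of `ℝ^M`
(only meaningful for `m ≥ 1`). -/
def grid (M m : ℕ) : Finset (Fin M → ℝ) :=
  Finset.univ.image fun k : Fin m → Fin M ↦ (m : ℝ)⁻¹ • ∑ q, Pi.single (k q) (1 : ℝ)

/-- The matrices `A_u` of the estimators `μ_u`, `u` in the grid. -/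
def gridMatrix {M : ℕ} (m : ℕ) (A : Fin M → Matrix (Fin n) (Fin n) ℝ) (u : grid M m) :
    Matrix (Fin n) (Fin n) ℝ :=
  mixMatrix A u.1

/-- The vectors `b_u` of the estimators `μ_u`, `u` in the grid. -/
def gridVector {M : ℕ} (m : ℕ) (b : Fin M → EuclideanSpace ℝ (Fin n)) (u : grid M m) :
    EuclideanSpace ℝ (Fin n) :=
  mixVector b u.1

end AffineAggregation

end

/-! ### Exponential moments of centred squares of Gaussians. -/

namespace AffineAggregation

/-! `Cp` at `θ` equals the loss `‖μ_θ - f‖²`, minus `‖f‖²`, minus a noise term linear in `θ`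
(`Cp_eq`). Comparing two points of the simplex therefore only requires control of the increments of
the noise between pairs of vertices. Each increment is a linear plus a centred quadratic form in a
Gaussian vector, with exponential tails (`linear_tail`, `quadratic_tail`). A union bound over
ordered pairs costs `2 log M`, and the resulting event serves all `θ` at once, which gives (i).

For (ii), the first-order condition for `Hpen` at its minimizer, in the direction of a vertex `q`,
compares the loss with that of `μ_q`, up to a `θ`-average of increments, each lowered by `‖μ_j -
μ_q‖² / 2` (`Hpen_argmin_risk_le`). This negative square absorbs the variances of both Gaussian
forms, leaving a deviation of order `σ² x` without any `√x` term (`hpen_increment_tail`). The price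
of aggregating the grid is then `σ²` times the logarithm of its cardinality. Maurey's argument shows
that the grid approximates the simplex within `S / m`, where `S` bounds all `‖μ_j‖²`; the third
exceptional event, on the noise norm, provides `S`. With `a = √(log(1 + M/√n) / n)` and `m = ⌊1/a⌋`,
both `1/m` and the log-cardinality divided by `n` are of order `a` (`gridSize_bounds`). -/

lemma neg_log_one_sub_sub_le {w : ℝ} (hw : |w| < 1) :
    -Real.log (1 - w) - w ≤ w ^ 2 / (2 * (1 - |w|)) := by
  have h1 := (hasSum_nat_add_iff' 1).2 (Real.hasSum_pow_div_log_of_abs_lt_one hw)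
  have h2 := (hasSum_geometric_of_lt_one (abs_nonneg w) hw).mul_left (w ^ 2 / 2)
  have h3 := hasSum_le (fun k ↦ ?_) h1 h2
  · rw [show w ^ 2 / (2 * (1 - |w|)) = w ^ 2 / 2 * (1 - |w|)⁻¹ by rw [div_mul_eq_div_div, div_eq_mul_inv]]
    simpa using h3
  -- The series of `-log (1 - w) - w` is compared termwise with a geometric one, bounding each
  -- denominator `k + 2` below by `2`.
  · have h4 : w ^ (k + 1 + 1) ≤ w ^ 2 * |w| ^ k := by
      calc w ^ (k + 1 + 1) ≤ |w ^ (k + 1 + 1)| := le_abs_self _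
        _ = w ^ 2 * |w| ^ k := by rw [abs_pow, ← sq_abs w]; ring
    have h5 : 0 ≤ w ^ 2 * |w| ^ k := by positivity
    rw [div_le_iff₀ (by positivity)]
    push_cast
    have : (0 : ℝ) ≤ k := by positivity
    nlinarith

lemma gaussianPDFReal_mul_exp (u x : ℝ) :
    gaussianPDFReal 0 1 x * Real.exp (u * (x ^ 2 - 1)) =
      (√(2 * Real.pi))⁻¹ * Real.exp (-u) * Real.exp (-(1 / 2 - u) * x ^ 2) := by
  simp only [gaussianPDFReal, mul_assoc]
  rw [← Real.exp_add, ← Real.exp_add, NNReal.coe_one]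
  ring_nf

lemma integrable_exp_sq_sub_one {u : ℝ} (hu : u < 1 / 2) :
    Integrable (fun x : ℝ ↦ Real.exp (u * (x ^ 2 - 1))) (gaussianReal 0 1) := by
  rw [gaussianReal_of_var_ne_zero 0 one_ne_zero,
    integrable_withDensity_iff_integrable_smul' (measurable_gaussianPDF 0 1)
      (ae_of_all _ fun x ↦ by simp [gaussianPDF])]
  simp only [gaussianPDF, ENNReal.toReal_ofReal (gaussianPDFReal_nonneg 0 1 _), smul_eq_mul,
    gaussianPDFReal_mul_exp]
  exact (integrable_exp_neg_mul_sq (by linarith)).const_mul _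

lemma integral_exp_sq_sub_one {u : ℝ} (hu : u < 1 / 2) :
    ∫ x : ℝ, Real.exp (u * (x ^ 2 - 1)) ∂gaussianReal 0 1 =
      Real.exp (-u) / √(1 - 2 * u) := by
  rw [integral_gaussianReal_eq_integral_smul one_ne_zero]
  simp only [smul_eq_mul, gaussianPDFReal_mul_exp]
  rw [integral_const_mul, integral_gaussian, mul_comm _ (Real.exp (-u)), mul_assoc,
    div_eq_mul_inv (Real.exp (-u)), ← Real.sqrt_inv, ← Real.sqrt_inv (1 - 2 * u), ← Real.sqrt_mul (by positivity)]
  congr 2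
  have : 1 - 2 * u ≠ 0 := by linarith
  have : 1 / 2 - u ≠ 0 := by linarith
  field_simp

lemma integral_exp_sq_sub_one_le {u s : ℝ} (hu : |u| ≤ s) (hs : s < 1 / 2) :
    ∫ x : ℝ, Real.exp (u * (x ^ 2 - 1)) ∂gaussianReal 0 1 ≤
      Real.exp (u ^ 2 / (1 - 2 * s)) := by
  have hu' := abs_le.1 hu
  have hpos : 0 < 1 - 2 * u := by linarith
  rw [integral_exp_sq_sub_one (by linarith), Real.sqrt_eq_rpow, Real.rpow_def_of_pos hpos,
    ← Real.exp_sub, Real.exp_le_exp]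
  have h2 : |2 * u| = 2 * |u| := by rw [abs_mul]; norm_num
  have h := neg_log_one_sub_sub_le (w := 2 * u) (by linarith)
  have h3 : (2 * u) ^ 2 / (2 * (1 - |2 * u|)) ≤ 2 * (u ^ 2 / (1 - 2 * s)) := by
    rw [h2, show (2 * u) ^ 2 / (2 * (1 - 2 * |u|)) = 2 * (u ^ 2 / (1 - 2 * |u|)) by
      field_simp]
    gcongr
    linarith
  linarith

/-! ### Hilbert-Schmidt norm and tails of linear and quadratic Gaussian forms. -/

section Tails

variable {E : Type*} [NormedAddCommGroup E] [InnerProductSpace ℝ E] [FiniteDimensional ℝ E]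

/-- The square of the Hilbert-Schmidt norm. -/
noncomputable def hsSq (T : E →L[ℝ] E) : ℝ :=
  ∑ i, ‖T (stdOrthonormalBasis ℝ E i)‖ ^ 2

lemma hsSq_eq_trace (T : E →L[ℝ] E) :
    hsSq T = LinearMap.trace ℝ E ((T.adjoint : E →ₗ[ℝ] E) * (T : E →ₗ[ℝ] E)) := by
  rw [LinearMap.trace_eq_sum_inner _ (stdOrthonormalBasis ℝ E), hsSq]
  refine Finset.sum_congr rfl fun i _ ↦ ?_
  simp [ContinuousLinearMap.adjoint_inner_right]

lemma hsSq_eq_sum {ι : Type*} [Fintype ι] (T : E →L[ℝ] E) (b : OrthonormalBasis ι ℝ E) :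
    hsSq T = ∑ i, ‖T (b i)‖ ^ 2 := by
  rw [hsSq_eq_trace, LinearMap.trace_eq_sum_inner _ b]
  refine Finset.sum_congr rfl fun i _ ↦ ?_
  simp [ContinuousLinearMap.adjoint_inner_right]

lemma hsSq_adjoint (T : E →L[ℝ] E) : hsSq T.adjoint = hsSq T := by
  rw [hsSq_eq_trace, hsSq_eq_trace, LinearMap.trace_mul_comm, ContinuousLinearMap.adjoint_adjoint]

lemma trace_adjoint (T : E →L[ℝ] E) :
    LinearMap.trace ℝ E (T.adjoint : E →ₗ[ℝ] E) = LinearMap.trace ℝ E (T : E →ₗ[ℝ] E) := by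
  simp only [LinearMap.trace_eq_sum_inner _ (stdOrthonormalBasis ℝ E)]
  refine Finset.sum_congr rfl fun i _ ↦ ?_
  simp [ContinuousLinearMap.adjoint_inner_right, real_inner_comm]

lemma hsSq_le_of_norm_apply_le {S T : E →L[ℝ] E} {c : ℝ} (h : ∀ v, ‖S v‖ ≤ c * ‖T v‖) :
    hsSq S ≤ c ^ 2 * hsSq T := by
  rw [hsSq, hsSq, Finset.mul_sum]
  refine Finset.sum_le_sum fun i _ ↦ ?_
  rw [← mul_pow]
  exact pow_le_pow_left₀ (norm_nonneg _) (h _) 2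

lemma hsSq_le_finrank {T : E →L[ℝ] E} {c : ℝ} (h : ‖T‖ ≤ c) :
    hsSq T ≤ c ^ 2 * Module.finrank ℝ E := by
  have := hsSq_le_of_norm_apply_le (S := T) (T := ContinuousLinearMap.id ℝ E) (c := c)
    fun v ↦ T.le_of_opNorm_le h v
  simpa [hsSq] using this

/-- Convexity of the squared norm, together with invariance under the adjoint. -/
lemma hsSq_symmetrization_le (T : E →L[ℝ] E) :
    hsSq ((1 / 2 : ℝ) • (T + T.adjoint)) ≤ hsSq T := by
  have h : hsSq ((1 / 2 : ℝ) • (T + T.adjoint)) ≤ 1 / 2 * hsSq T + 1 / 2 * hsSq T.adjoint := by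
    simp only [hsSq, Finset.mul_sum, ← Finset.sum_add_distrib]
    refine Finset.sum_le_sum fun i _ ↦ ?_
    set e := stdOrthonormalBasis ℝ E i
    have h1 : ‖((1 / 2 : ℝ) • (T + T.adjoint)) e‖ ≤ 1 / 2 * (‖T e‖ + ‖T.adjoint e‖) := by
      simp only [smul_apply, add_apply, norm_smul]
      norm_num
      exact norm_add_le _ _
    have h2 := pow_le_pow_left₀ (norm_nonneg _) h1 2
    nlinarith [sq_nonneg (‖T e‖ - ‖T.adjoint e‖)]
  rw [hsSq_adjoint] at h
  linarith

lemma apply_eigenvectorBasis_eq_smul {T : E →L[ℝ] E} (hT : (T : E →ₗ[ℝ] E).IsSymmetric)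
    (i : Fin (Module.finrank ℝ E)) :
    T (hT.eigenvectorBasis rfl i) = hT.eigenvalues rfl i • hT.eigenvectorBasis rfl i :=
  hT.apply_eigenvectorBasis rfl i

lemma inner_apply_sum_eigenvectorBasis {T : E →L[ℝ] E} (hT : (T : E →ₗ[ℝ] E).IsSymmetric)
    (x : Fin (Module.finrank ℝ E) → ℝ) :
    inner ℝ (∑ i, x i • hT.eigenvectorBasis rfl i) (T (∑ i, x i • hT.eigenvectorBasis rfl i))
      = ∑ i, hT.eigenvalues rfl i * x i ^ 2 := by
  simp only [map_sum, map_smul, apply_eigenvectorBasis_eq_smul, smul_smul]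
  rw [(hT.eigenvectorBasis rfl).orthonormal.inner_sum]
  refine Finset.sum_congr rfl fun i _ ↦ ?_
  simp
  ring

variable [MeasurableSpace E] [BorelSpace E]

lemma chernoff_bound {X : E → ℝ} {t a x ψ : ℝ} (ht : 0 ≤ t)
    (hint : Integrable (fun z ↦ Real.exp (t * X z)) (stdGaussian E))
    (hmgf : ∫ z, Real.exp (t * X z) ∂stdGaussian E ≤ Real.exp ψ) (hx : ψ + x ≤ t * a) :
    (stdGaussian E).real {z | a < X z} ≤ Real.exp (-x) := by
  calc (stdGaussian E).real {z | a < X z} ≤ (stdGaussian E).real {z | a ≤ X z} :=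
        measureReal_mono fun z (hz : a < X z) ↦ hz.le
    _ ≤ Real.exp (-t * a) * mgf X (stdGaussian E) t := measure_ge_le_exp_mul_mgf a ht hint
    _ ≤ Real.exp (-t * a) * Real.exp ψ := by gcongr; exact hmgf
    _ ≤ Real.exp (-x) := by rw [← Real.exp_add]; gcongr; linarith

/-- The Chernoff parameter `t` stays free instead of being optimized, so that the variance part `t *
V / 2` can later be matched with a term to be absorbed. -/
lemma linear_tail (v : E) {t V x : ℝ} (ht : 0 < t) (hV : ‖v‖ ^ 2 ≤ V) :
    (stdGaussian E).real {z | t * V / 2 + x / t < inner ℝ z v} ≤ Real.exp (-x) := by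
  have hlaw : (stdGaussian E).map (fun z ↦ inner ℝ z v) = gaussianReal 0 (‖v‖₊ ^ 2) := by
    have h := IsGaussian.map_eq_gaussianReal (μ := stdGaussian E) (innerSL ℝ v)
    rw [variance_dual_stdGaussian, integral_strongDual_stdGaussian, innerSL_apply_norm] at h
    convert h using 2
    · ext z; simp [real_inner_comm]
    · ext; simp
  refine chernoff_bound (t := t) (ψ := t ^ 2 * V / 2) ht.le ?_ ?_ ?_
  · have h := integrable_exp_mul_gaussianReal (μ := 0) (v := ‖v‖₊ ^ 2) t
    rw [← hlaw, integrable_map_measure (by fun_prop) (by fun_prop)] at h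
    exact h
  · have h := mgf_gaussianReal hlaw t
    rw [mgf] at h
    rw [h, Real.exp_le_exp]
    simp
    nlinarith [mul_le_mul_of_nonneg_left hV (sq_nonneg t)]
  · rw [mul_add, mul_div_cancel₀ _ ht.ne']
    linarith [show t * (t * V / 2) = t ^ 2 * V / 2 by ring]

/-- In an eigenbasis of `T` the coordinates of a standard Gaussian are independent and standard, so
the exponential moment factors into those of the centred variables `l i * (x i ^ 2 - 1)`. -/
lemma quadratic_mgf {T : E →L[ℝ] E} (hT : (T : E →ₗ[ℝ] E).IsSymmetric) {K V t : ℝ}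
    (hK : ‖T‖ ≤ K) (hV : hsSq T ≤ V) (ht : 0 ≤ t) (htK : t * K < 1 / 2) :
    Integrable (fun z ↦ Real.exp (t * (inner ℝ z (T z) - LinearMap.trace ℝ E (T : E →ₗ[ℝ] E))))
      (stdGaussian E) ∧
    ∫ z, Real.exp (t * (inner ℝ z (T z) - LinearMap.trace ℝ E (T : E →ₗ[ℝ] E))) ∂stdGaussian E
      ≤ Real.exp (t ^ 2 * V / (1 - 2 * (t * K))) := by
  set b := hT.eigenvectorBasis rfl with hb
  set l := hT.eigenvalues rfl with hl
  have hnorm : ∀ i, ‖T (b i)‖ = |l i| := fun i ↦ by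
    rw [hb, apply_eigenvectorBasis_eq_smul, norm_smul, OrthonormalBasis.norm_eq_one, mul_one,
      Real.norm_eq_abs]
  have habs : ∀ i, |t * l i| ≤ t * K := fun i ↦ by
    rw [abs_mul, abs_of_nonneg ht, ← hnorm]
    gcongr
    simpa using (T.le_of_opNorm_le hK (b i))
  have hlt : ∀ i, t * l i < 1 / 2 := fun i ↦ ((abs_le.1 (habs i)).2).trans_lt htK
  have hsum : ∑ i, l i ^ 2 = hsSq T := by
    rw [hsSq_eq_sum T b]
    simp [hnorm]
  have hfun : ∀ x : Fin (Module.finrank ℝ E) → ℝ,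
      Real.exp (t * (inner ℝ (∑ i, x i • b i) (T (∑ i, x i • b i))
        - LinearMap.trace ℝ E (T : E →ₗ[ℝ] E))) =
      ∏ i, Real.exp (t * l i * (x i ^ 2 - 1)) := fun x ↦ by
    rw [inner_apply_sum_eigenvectorBasis, hT.trace_eq_sum_eigenvalues rfl, ← Real.exp_sum]
    congr 1
    simp only [RCLike.ofReal_real_eq_id, id, ← Finset.sum_sub_distrib, Finset.mul_sum]
    exact Finset.sum_congr rfl fun i _ ↦ by ring
  have hmeas : AEMeasurable (fun x : Fin (Module.finrank ℝ E) → ℝ ↦ ∑ i, x i • b i)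
      (Measure.pi fun _ ↦ gaussianReal 0 1) := Measurable.aemeasurable (by fun_prop)
  have hcont : Continuous fun z ↦
      Real.exp (t * (inner ℝ z (T z) - LinearMap.trace ℝ E (T : E →ₗ[ℝ] E))) := by fun_prop
  rw [stdGaussian_eq_map_pi_orthonormalBasis b,
    integrable_map_measure hcont.aestronglyMeasurable hmeas,
    integral_map hmeas hcont.aestronglyMeasurable]
  simp only [Function.comp_def, hfun]
  refine ⟨Integrable.fintype_prod (f := fun i x ↦ Real.exp (t * l i * (x ^ 2 - 1)))
    fun i ↦ integrable_exp_sq_sub_one (hlt i), ?_⟩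
  rw [integral_fintype_prod_eq_prod (f := fun i x ↦ Real.exp (t * l i * (x ^ 2 - 1)))]
  calc ∏ i, ∫ x, Real.exp (t * l i * (x ^ 2 - 1)) ∂gaussianReal 0 1
      ≤ ∏ i, Real.exp ((t * l i) ^ 2 / (1 - 2 * (t * K))) :=
        Finset.prod_le_prod (fun i _ ↦ integral_nonneg fun _ ↦ (Real.exp_pos _).le)
          fun i _ ↦ integral_exp_sq_sub_one_le (habs i) htK
    _ = Real.exp (t ^ 2 * hsSq T / (1 - 2 * (t * K))) := by
        rw [← Real.exp_sum, ← hsum, Finset.mul_sum, Finset.sum_div]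
        simp only [mul_pow]
    _ ≤ _ := by
        gcongr
        linarith

/-- Concentration of a Gaussian quadratic form (Hanson-Wright inequality with explicit constants,
in linearized form). -/
lemma quadratic_tail (T : E →L[ℝ] E) {K V s x : ℝ} (hK : ‖T‖ ≤ K) (hV : hsSq T ≤ V) (hs : 0 < s) :
    (stdGaussian E).real {z | s * V + (1 / s + 2 * K) * x <
      inner ℝ z (T z) - LinearMap.trace ℝ E (T : E →ₗ[ℝ] E)} ≤ Real.exp (-x) := by
  -- The quadratic form and the trace only see the symmetric part, and symmetrizing increases
  -- neither norm.
  set S : E →L[ℝ] E := (1 / 2 : ℝ) • (T + T.adjoint) with hS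
  have hK0 : 0 ≤ K := (norm_nonneg _).trans hK
  have hSsymm : (S : E →ₗ[ℝ] E).IsSymmetric := fun u v ↦ by
    simp [hS, inner_smul_left, inner_smul_right, inner_add_left, inner_add_right,
      ContinuousLinearMap.adjoint_inner_left, ContinuousLinearMap.adjoint_inner_right]
    ring
  have hSK : ‖S‖ ≤ K := by
    rw [hS, norm_smul]
    have := norm_add_le T T.adjoint
    rw [LinearIsometryEquiv.norm_map] at this
    norm_num
    linarith
  have htr : LinearMap.trace ℝ E (S : E →ₗ[ℝ] E) = LinearMap.trace ℝ E (T : E →ₗ[ℝ] E) := by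
    have := trace_adjoint T
    simp [hS, this]
    ring
  have hin : ∀ z, inner ℝ z (S z) = inner ℝ z (T z) := fun z ↦ by
    simp [hS, inner_smul_right, inner_add_right, ContinuousLinearMap.adjoint_inner_right,
      real_inner_comm]
    ring
  simp only [← hin, ← htr]
  -- With `t = 1 / D`, the denominator `1 - 2 t K` equals `1 / (s D)`, so the exponent is `s V / D`
  -- and the Chernoff condition is an equality.
  set D := 1 / s + 2 * K with hD
  have hDpos : 0 < D := by positivity
  have h1 : 1 - 2 * (1 / D * K) = 1 / s / D := by
    field_simp
    rw [hD]
    field_simp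
    ring
  have h2 : 0 < 1 / s / D := by positivity
  obtain ⟨hi, hm⟩ := quadratic_mgf hSsymm hSK ((hsSq_symmetrization_le T).trans hV)
    (t := 1 / D) (by positivity) (by linarith)
  refine chernoff_bound (t := 1 / D) (by positivity) hi hm ?_
  rw [h1]
  apply le_of_eq
  field_simp

end Tails
end AffineAggregation

namespace AffineAggregation

/-! ### Tails of the noise increments between two estimators, and the union bound. -/

section PairEvents

variable {E : Type*} [NormedAddCommGroup E] [InnerProductSpace ℝ E] [FiniteDimensional ℝ E]
  [MeasurableSpace E] [BorelSpace E]

lemma cp_increment_tail (T : E →L[ℝ] E) (v : E) {N R σ x : ℝ} (hN : N = Module.finrank ℝ E)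
    (hN0 : 0 < N) (hR : 0 < R) (hσ : 0 ≤ σ) (hx : 0 < x) (hT : ‖T‖ ≤ 2)
    (hv : ‖v‖ ≤ 4 * R * √N) :
    (stdGaussian E).real {z | N * (8 * (σ ^ 2 + σ * R * √2) * √(x / N) + 8 * σ ^ 2 * x / N) <
      2 * (inner ℝ (σ • z) (v + T (σ • z)) - σ ^ 2 * LinearMap.trace ℝ E (T : E →ₗ[ℝ] E))} ≤
      2 * Real.exp (-x) := by
  set r := √(x / N) with hr
  have hr0 : 0 < r := by positivity
  have hxr : x = N * r ^ 2 := by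
    rw [hr, Real.sq_sqrt (by positivity)]; field_simp
  have h2 : √2 ^ 2 = (2 : ℝ) := Real.sq_sqrt (by norm_num)
  have hhs : hsSq T ≤ 4 * N := by
    have := hsSq_le_finrank hT
    rw [hN]; linarith
  have hv2 : ‖v‖ ^ 2 ≤ 16 * R ^ 2 * N := by
    have := pow_le_pow_left₀ (norm_nonneg _) hv 2
    rw [mul_pow, Real.sq_sqrt hN0.le] at this
    linarith
  -- The values of `s` and `t` balance the two halves of each bound: `s V = x / s` and `t V / 2 = x
  -- / t`.
  have hq := quadratic_tail T hT hhs (s := r / 2) (x := x) (by positivity)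
  have hl := linear_tail v (t := r * √2 / (4 * R)) (x := x) (by positivity) hv2
  have e1 : r / 2 * (4 * N) + (1 / (r / 2) + 2 * 2) * x = 4 * N * r + 4 * x := by
    rw [hxr]; field_simp; ring
  have e2 : r * √2 / (4 * R) * (16 * R ^ 2 * N) / 2 + x / (r * √2 / (4 * R)) =
      4 * √2 * R * N * r := by
    rw [hxr]; field_simp; rw [h2]; ring
  have e3 : N * (8 * (σ ^ 2 + σ * R * √2) * r + 8 * σ ^ 2 * x / N) =
      2 * σ * (4 * √2 * R * N * r) + 2 * σ ^ 2 * (4 * N * r + 4 * x) := by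
    field_simp; ring
  rw [e1] at hq
  rw [e2] at hl
  rw [e3]
  refine (measureReal_mono (s₂ := _ ∪ _) fun z hz ↦ ?_).trans
    ((measureReal_union_le _ _).trans ((add_le_add hq hl).trans_eq (two_mul _).symm))
  by_contra hcon
  simp only [Set.mem_union, Set.mem_ofPred_eq, not_or, not_lt] at hcon hz
  simp only [map_smul, inner_add_right, inner_smul_left, inner_smul_right,
    RCLike.conj_to_real] at hz
  nlinarith [mul_le_mul_of_nonneg_left hcon.1 (sq_nonneg σ), mul_le_mul_of_nonneg_left hcon.2 hσ]

/-- Expanding the square gives `σ² (⟨z, S z⟩ - Tr S) + ⟨z, σ w⟩ - σ² hsSq T / 2 - ‖v‖² / 2`, with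
`S` and `w` as set below. The variance proxies of the two forms are at most multiples of `hsSq T`
and `σ² ‖v‖²`, so the negative terms can cancel them. -/
lemma hpen_increment_tail (T : E →L[ℝ] E) (v : E) {σ x : ℝ} (hσ : 0 ≤ σ) (hT : ‖T‖ ≤ 2) :
    (stdGaussian E).real {z | 46 * σ ^ 2 * x <
      2 * (inner ℝ (σ • z) (v + T (σ • z)) - σ ^ 2 * LinearMap.trace ℝ E (T : E →ₗ[ℝ] E))
        - 1 / 2 * ‖v + T (σ • z)‖ ^ 2} ≤
      2 * Real.exp (-x) := by
  -- The Chernoff parameter `1 / (16 σ²)` used below requires `σ ≠ 0`.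
  rcases hσ.eq_or_lt with rfl | hσ
  · have hempty : {z : E | 46 * (0 : ℝ) ^ 2 * x < 2 * (inner ℝ ((0 : ℝ) • z) (v + T ((0 : ℝ) • z))
        - (0 : ℝ) ^ 2 * LinearMap.trace ℝ E (T : E →ₗ[ℝ] E))
        - 1 / 2 * ‖v + T ((0 : ℝ) • z)‖ ^ 2} = ∅ := by
      refine Set.eq_empty_of_forall_notMem fun z hz ↦ ?_
      simp only [Set.mem_ofPred_eq, zero_smul, inner_zero_left, map_zero, add_zero] at hz
      nlinarith [sq_nonneg ‖v‖]
    rw [hempty, measureReal_empty]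
    positivity
  set w : E := (2 : ℝ) • v - T.adjoint v with hw
  set S : E →L[ℝ] E := (2 : ℝ) • T - (1 / 2 : ℝ) • (T.adjoint * T) with hS
  have hTadj : ‖T.adjoint‖ ≤ 2 := by rwa [LinearIsometryEquiv.norm_map]
  have hSv : ∀ u, ‖S u‖ ≤ 3 * ‖T u‖ := fun u ↦ by
    have h1 := T.adjoint.le_of_opNorm_le hTadj (T u)
    have h2 : ‖S u‖ ≤ ‖(2 : ℝ) • T u‖ + ‖(1 / 2 : ℝ) • T.adjoint (T u)‖ := by
      simpa [hS] using norm_sub_le ((2 : ℝ) • T u) ((1 / 2 : ℝ) • T.adjoint (T u))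
    rw [norm_smul, norm_smul] at h2
    norm_num at h2
    linarith
  have hSK : ‖S‖ ≤ 6 := S.opNorm_le_bound (by norm_num) fun u ↦ by
    linarith [hSv u, T.le_of_opNorm_le hT u]
  have hShs : hsSq S ≤ 9 * hsSq T := by
    have := hsSq_le_of_norm_apply_le hSv
    linarith
  have hwv : ‖σ • w‖ ^ 2 ≤ 16 * σ ^ 2 * ‖v‖ ^ 2 := by
    have h1 := T.adjoint.le_of_opNorm_le hTadj v
    have h2 : ‖w‖ ≤ ‖(2 : ℝ) • v‖ + ‖T.adjoint v‖ := norm_sub_le _ _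
    rw [norm_smul] at h2
    norm_num at h2
    have h3 := pow_le_pow_left₀ (norm_nonneg _) (show ‖w‖ ≤ 4 * ‖v‖ by linarith) 2
    rw [norm_smul, mul_pow, Real.norm_eq_abs, sq_abs]
    nlinarith [mul_le_mul_of_nonneg_left h3 (sq_nonneg σ)]
  have htr : LinearMap.trace ℝ E (S : E →ₗ[ℝ] E) =
      2 * LinearMap.trace ℝ E (T : E →ₗ[ℝ] E) - 1 / 2 * hsSq T := by
    rw [hsSq_eq_trace]
    simp [hS]
  -- The parameters make the variance parts exactly `hsSq T / 2` and `‖v‖² / 2`; what remains is `30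
  -- σ² x + 16 σ² x = 46 σ² x`.
  have hq := quadratic_tail S hSK hShs (s := 1 / 18) (x := x) (by positivity)
  have hl := linear_tail (σ • w) (t := 1 / (16 * σ ^ 2)) (x := x) (by positivity) hwv
  have e1 : 1 / 18 * (9 * hsSq T) + (1 / (1 / 18) + 2 * 6) * x = 1 / 2 * hsSq T + 30 * x := by
    ring
  have e2 : 1 / (16 * σ ^ 2) * (16 * σ ^ 2 * ‖v‖ ^ 2) / 2 + x / (1 / (16 * σ ^ 2)) =
      1 / 2 * ‖v‖ ^ 2 + 16 * σ ^ 2 * x := by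
    field_simp
  rw [e1] at hq
  rw [e2] at hl
  refine (measureReal_mono (s₂ := _ ∪ _) fun z hz ↦ ?_).trans
    ((measureReal_union_le _ _).trans ((add_le_add hq hl).trans_eq (two_mul _).symm))
  by_contra hcon
  simp only [Set.mem_union, Set.mem_ofPred_eq, not_or, not_lt] at hcon hz
  obtain ⟨h1, h2⟩ := hcon
  have h3 : inner ℝ z (S z) = 2 * inner ℝ z (T z) - 1 / 2 * ‖T z‖ ^ 2 := by
    simp [hS, inner_sub_right, inner_smul_right, ContinuousLinearMap.adjoint_inner_right]
  have h4 : inner ℝ z (σ • w) = σ * (2 * inner ℝ z v - inner ℝ v (T z)) := by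
    simp [hw, inner_sub_right, inner_smul_right, ContinuousLinearMap.adjoint_inner_right,
      real_inner_comm]
  rw [norm_add_sq_real] at hz
  simp only [map_smul, inner_add_right, inner_smul_left, inner_smul_right, norm_smul, mul_pow,
    Real.norm_eq_abs, sq_abs, RCLike.conj_to_real] at hz
  rw [h3, htr] at h1
  rw [h4] at h2
  nlinarith [mul_le_mul_of_nonneg_left h1 (sq_nonneg σ)]

lemma noise_norm_tail (σ x : ℝ) :
    (stdGaussian E).real {z | σ ^ 2 * (2 * Module.finrank ℝ E + 3 * x) < ‖σ • z‖ ^ 2} ≤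
      Real.exp (-x) := by
  have hhs : hsSq (ContinuousLinearMap.id ℝ E) ≤ Module.finrank ℝ E := by simp [hsSq]
  have h := quadratic_tail (ContinuousLinearMap.id ℝ E) ContinuousLinearMap.norm_id_le hhs
    (s := 1) (x := x) one_pos
  refine (measureReal_mono fun z hz ↦ ?_).trans h
  simp only [Set.mem_ofPred_eq, norm_smul, mul_pow, Real.norm_eq_abs, sq_abs] at hz ⊢
  have := lt_of_mul_lt_mul_left hz (sq_nonneg σ)
  simp
  linarith

/-- The level `x + 2 log N` divides each tail by `N²`. Only `N² - N` pairs are off-diagonal, which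
makes the final inequality strict. -/
lemma measureReal_offDiag_union_lt {α ι : Type*} [MeasurableSpace α] [Fintype ι] [Nonempty ι]
    (μ : Measure α) [IsFiniteMeasure μ] {c x : ℝ} (hc : 0 < c) (S : ι → ι → Set α)
    (hS : ∀ j k, j ≠ k →
      μ.real (S j k) ≤ c * Real.exp (-(x + 2 * Real.log (Fintype.card ι)))) :
    μ.real {z | ∃ j k, j ≠ k ∧ z ∈ S j k} < c * Real.exp (-x) := by
  classical
  set N : ℝ := (Fintype.card ι : ℝ) with hN
  have hN0 : 0 < N := by rw [hN]; exact_mod_cast Fintype.card_pos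
  have hexp : Real.exp (-(x + 2 * Real.log N)) = Real.exp (-x) / N ^ 2 := by
    rw [neg_add, Real.exp_add, Real.exp_neg (2 * _), two_mul, Real.exp_add, Real.exp_log hN0]
    ring
  have hset : {z | ∃ j k, j ≠ k ∧ z ∈ S j k} =
      ⋃ p ∈ (Finset.univ : Finset ι).offDiag, S p.1 p.2 := by
    ext z; simp
  rw [hset]
  calc _ ≤ ∑ p ∈ (Finset.univ : Finset ι).offDiag, μ.real (S p.1 p.2) :=
        measureReal_biUnion_finset_le _ _
    _ ≤ ∑ p ∈ (Finset.univ : Finset ι).offDiag, c * (Real.exp (-x) / N ^ 2) :=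
        Finset.sum_le_sum fun p hp ↦ by
          rw [← hexp]; exact hS _ _ (Finset.mem_offDiag.1 hp).2.2
    _ = (N * N - N) * (c * (Real.exp (-x) / N ^ 2)) := by
        rw [Finset.sum_const, Finset.offDiag_card, nsmul_eq_mul, Finset.card_univ,
          Nat.cast_sub (Nat.le_mul_self _), Nat.cast_mul]
    _ < N ^ 2 * (c * (Real.exp (-x) / N ^ 2)) := by
        gcongr
        linarith
    _ = c * Real.exp (-x) := by field_simp

end PairEvents

/-! ### Deterministic comparison of the losses. -/

section Deterministic

variable {n : ℕ} {ι : Type*} [Fintype ι]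

lemma mixEst_eq_sum (A : ι → Matrix (Fin n) (Fin n) ℝ) (b : ι → EuclideanSpace ℝ (Fin n))
    (y : EuclideanSpace ℝ (Fin n)) (θ : ι → ℝ) :
    mixEst A b y θ = ∑ j, θ j • affineEst (A j) (b j) y := by
  simp [mixEst, affineEst, mixMatrix, mixVector, Finset.sum_add_distrib, map_sum]

/-- `2 (⟨ξ, μ_j⟩ - σ² Tr A_j)`, whose increments drive the deviation of the criteria. -/
noncomputable def noiseTerm (σ : ℝ) (A : Matrix (Fin n) (Fin n) ℝ)
    (b f ξ : EuclideanSpace ℝ (Fin n)) : ℝ :=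
  2 * (inner ℝ ξ (affineEst A b (f + ξ)) - σ ^ 2 * A.trace)

lemma Cp_eq (σ : ℝ) (A : ι → Matrix (Fin n) (Fin n) ℝ) (b : ι → EuclideanSpace ℝ (Fin n))
    (f ξ : EuclideanSpace ℝ (Fin n)) (θ : ι → ℝ) :
    Cp σ A b (f + ξ) θ = ‖mixEst A b (f + ξ) θ - f‖ ^ 2 - ‖f‖ ^ 2
      - ∑ j, θ j * noiseTerm σ (A j) (b j) f ξ := by
  have h1 : ∑ j, θ j * noiseTerm σ (A j) (b j) f ξ =
      2 * (inner ℝ ξ (mixEst A b (f + ξ) θ) - σ ^ 2 * (mixMatrix A θ).trace) := by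
    simp only [noiseTerm, mixEst_eq_sum, mixMatrix, Matrix.trace_sum, Matrix.trace_smul, inner_sum,
      inner_smul_right, Finset.mul_sum, ← Finset.sum_sub_distrib, smul_eq_mul]
    exact Finset.sum_congr rfl fun j _ ↦ by ring
  rw [h1, Cp, norm_sub_sq_real, inner_add_left, real_inner_comm f]
  ring

lemma pen_eq (A : ι → Matrix (Fin n) (Fin n) ℝ) (b : ι → EuclideanSpace ℝ (Fin n))
    (y : EuclideanSpace ℝ (Fin n)) {θ : ι → ℝ} (hθ : ∑ j, θ j = 1) :
    pen A b y θ = ∑ j, θ j * ‖affineEst (A j) (b j) y‖ ^ 2 - ‖mixEst A b y θ‖ ^ 2 := by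
  have h1 : ∑ j, θ j * inner ℝ (mixEst A b y θ) (affineEst (A j) (b j) y) =
      ‖mixEst A b y θ‖ ^ 2 := by
    rw [← real_inner_self_eq_norm_sq]
    conv_rhs => rw [mixEst_eq_sum A b y θ, inner_sum]
    simp only [inner_smul_right, ← mixEst_eq_sum]
  have h2 : ∑ j, θ j * ‖mixEst A b y θ‖ ^ 2 = ‖mixEst A b y θ‖ ^ 2 := by
    rw [← Finset.sum_mul, hθ, one_mul]
  calc pen A b y θ = ∑ j, θ j * ‖mixEst A b y θ‖ ^ 2
        - 2 * ∑ j, θ j * inner ℝ (mixEst A b y θ) (affineEst (A j) (b j) y)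
        + ∑ j, θ j * ‖affineEst (A j) (b j) y‖ ^ 2 := by
        rw [pen, Finset.mul_sum, ← Finset.sum_sub_distrib, ← Finset.sum_add_distrib]
        refine Finset.sum_congr rfl fun j _ ↦ ?_
        rw [norm_sub_sq_real]
        ring
    _ = _ := by rw [h1, h2]; ring

lemma sum_mul_sub_sum_mul_le {θ θ' g : ι → ℝ} {T : ℝ} (hθ : θ ∈ stdSimplex ℝ ι)
    (hθ' : θ' ∈ stdSimplex ℝ ι) (h : ∀ j k, g j - g k ≤ T) :
    ∑ j, θ j * g j - ∑ k, θ' k * g k ≤ T := by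
  have h1 : ∀ k, ∑ j, θ j * g j - T ≤ g k := fun k ↦ by
    have : ∑ j, θ j * g j ≤ ∑ j, θ j * (g k + T) :=
      Finset.sum_le_sum fun j _ ↦ mul_le_mul_of_nonneg_left (by linarith [h j k]) (hθ.1 j)
    rw [← Finset.sum_mul, hθ.2] at this
    linarith
  have h2 : ∑ k, θ' k * (∑ j, θ j * g j - T) ≤ ∑ k, θ' k * g k :=
    Finset.sum_le_sum fun k _ ↦ mul_le_mul_of_nonneg_left (h1 k) (hθ'.1 k)
  rw [← Finset.sum_mul, hθ'.2] at h2
  linarith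

lemma Cp_argmin_risk_le {σ T : ℝ} {A : ι → Matrix (Fin n) (Fin n) ℝ}
    {b : ι → EuclideanSpace ℝ (Fin n)} {f ξ : EuclideanSpace ℝ (Fin n)} {θ θ' : ι → ℝ}
    (hθ : IsSimplexArgmin (Cp σ A b (f + ξ)) θ) (hθ' : θ' ∈ stdSimplex ℝ ι) (hT : 0 ≤ T)
    (h : ∀ j k, j ≠ k → noiseTerm σ (A j) (b j) f ξ - noiseTerm σ (A k) (b k) f ξ ≤ T) :
    ‖mixEst A b (f + ξ) θ - f‖ ^ 2 ≤ ‖mixEst A b (f + ξ) θ' - f‖ ^ 2 + T := by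
  have h1 : Cp σ A b (f + ξ) θ ≤ Cp σ A b (f + ξ) θ' := hθ.2 hθ'
  rw [Cp_eq, Cp_eq] at h1
  have h2 := sum_mul_sub_sum_mul_le (g := fun j ↦ noiseTerm σ (A j) (b j) f ξ) hθ.1 hθ'
    (T := T) fun j k ↦ by
      by_cases hjk : j = k
      · simpa [hjk] using hT
      · exact h j k hjk
  linarith

lemma nonneg_of_forall_quadratic_nonneg {a c : ℝ}
    (h : ∀ t, 0 < t → t ≤ 1 → 0 ≤ t * a + t ^ 2 * c) : 0 ≤ a := by
  by_contra! ha
  have hc := abs_nonneg c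
  have hd : 0 < -a + |c| := by linarith
  -- For this `t`, `t * |c| ≤ -a / 2`, so the linear term dominates and the quadratic would be
  -- negative.
  have ht := h (-a / (2 * (-a + |c|))) (div_pos (by linarith) (by linarith))
    ((div_le_one (by linarith)).2 (by linarith))
  set t := -a / (2 * (-a + |c|)) with htd
  have ht0 : 0 < t := div_pos (by linarith) (by linarith)
  have h1 : t * (2 * (-a + |c|)) = -a := by rw [htd]; field_simp
  nlinarith [mul_le_mul_of_nonneg_left (le_abs_self c) ht0.le]

/-- On the simplex the penalty is a variance, which turns `Hpen` into `‖μ_η‖² / 2 - 2 ⟨f, μ_η⟩` plus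
a linear term. Since half of the square survives, the first-order condition towards `q` leaves
exactly the `θ`-average of `-‖μ_j - μ_q‖² / 2`. -/
lemma Hpen_argmin_risk_le {σ T : ℝ} {A : ι → Matrix (Fin n) (Fin n) ℝ}
    {b : ι → EuclideanSpace ℝ (Fin n)} {f ξ : EuclideanSpace ℝ (Fin n)} {θ : ι → ℝ}
    (hθ : IsSimplexArgmin (Hpen σ A b (f + ξ)) θ) (hT : 0 ≤ T) (q : ι)
    (h : ∀ j, j ≠ q → noiseTerm σ (A j) (b j) f ξ - noiseTerm σ (A q) (b q) f ξ
      - 1 / 2 * ‖affineEst (A j) (b j) (f + ξ) - affineEst (A q) (b q) (f + ξ)‖ ^ 2 ≤ T) :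
    ‖mixEst A b (f + ξ) θ - f‖ ^ 2 ≤ ‖affineEst (A q) (b q) (f + ξ) - f‖ ^ 2 + T := by
  classical
  set y := f + ξ with hy
  set μ : ι → EuclideanSpace ℝ (Fin n) := fun j ↦ affineEst (A j) (b j) y with hμ
  set g : ι → ℝ := fun j ↦ noiseTerm σ (A j) (b j) f ξ with hg
  set m := mixEst A b y θ with hm
  have hmsum : m = ∑ j, θ j • μ j := mixEst_eq_sum _ _ _ _
  have hH : ∀ η ∈ stdSimplex ℝ ι, Hpen σ A b y η =
      1 / 2 * ‖mixEst A b y η‖ ^ 2 - 2 * inner ℝ f (mixEst A b y η)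
        + ∑ j, η j * (1 / 2 * ‖μ j‖ ^ 2 - g j) := fun η hη ↦ by
    have h1 : ∑ j, η j * (1 / 2 * ‖μ j‖ ^ 2 - g j) =
        1 / 2 * ∑ j, η j * ‖μ j‖ ^ 2 - ∑ j, η j * g j := by
      rw [Finset.mul_sum, ← Finset.sum_sub_distrib]
      exact Finset.sum_congr rfl fun j _ ↦ by ring
    rw [Hpen, Cp_eq, pen_eq _ _ _ hη.2, norm_sub_sq_real, real_inner_comm f, h1]
    ring
  have hcross : ∑ j, θ j * inner ℝ (μ j) (μ q) = inner ℝ m (μ q) := by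
    rw [hmsum, sum_inner]
    simp [inner_smul_left]
  set s := ∑ j, θ j * (1 / 2 * ‖μ j‖ ^ 2 - g j) with hs
  -- First-order optimality along the segment from `θ` to the vertex `q`.
  have hopt : 0 ≤ inner ℝ m (μ q - m) - 2 * inner ℝ f (μ q - m)
      + (1 / 2 * ‖μ q‖ ^ 2 - g q - s) := by
    refine nonneg_of_forall_quadratic_nonneg (c := 1 / 2 * ‖μ q - m‖ ^ 2) fun t ht0 ht1 ↦ ?_
    set η : ι → ℝ := (1 - t) • θ + t • Pi.single q 1 with hη
    have hηs : η ∈ stdSimplex ℝ ι :=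
      convex_stdSimplex ℝ ι hθ.1 (single_mem_stdSimplex ℝ q) (by linarith) ht0.le (by ring)
    have hsum : ∀ F : ι → ℝ, ∑ j, η j * F j = (1 - t) * ∑ j, θ j * F j + t * F q := fun F ↦ by
      simp [hη, add_mul, Finset.sum_add_distrib, Finset.mul_sum, mul_assoc, Pi.single_apply]
    have hmη : mixEst A b y η = m + t • (μ q - m) := by
      rw [mixEst_eq_sum]
      have : ∑ j, η j • μ j = (1 - t) • ∑ j, θ j • μ j + t • μ q := by
        simp [hη, add_smul, Finset.sum_add_distrib, Finset.smul_sum, mul_smul, Pi.single_apply]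
      change ∑ j, η j • μ j = _
      rw [this, ← hmsum]
      module
    have hmin : Hpen σ A b y θ ≤ Hpen σ A b y η := hθ.2 hηs
    rw [hH _ hθ.1, hH _ hηs, hmη, ← hm, ← hs, hsum, ← hs, norm_add_sq_real, norm_smul, mul_pow,
      Real.norm_eq_abs, sq_abs, inner_add_right, inner_smul_right, inner_smul_right] at hmin
    linarith
  have hj : ∑ j, θ j * (g j - g q - 1 / 2 * ‖μ j - μ q‖ ^ 2) ≤ T := by
    calc _ ≤ ∑ j, θ j * T := Finset.sum_le_sum fun j _ ↦
          mul_le_mul_of_nonneg_left (by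
            by_cases hjq : j = q
            · simpa [hjq] using hT
            · exact h j hjq) (hθ.1.1 j)
      _ = T := by rw [← Finset.sum_mul, hθ.1.2, one_mul]
  have hexpand : ∑ j, θ j * (g j - g q - 1 / 2 * ‖μ j - μ q‖ ^ 2) =
      -s + inner ℝ m (μ q) - (g q + 1 / 2 * ‖μ q‖ ^ 2) := by
    have hconst : ∑ j, θ j * (g q + 1 / 2 * ‖μ q‖ ^ 2) = g q + 1 / 2 * ‖μ q‖ ^ 2 := by
      rw [← Finset.sum_mul, hθ.1.2, one_mul]
    rw [← hcross, ← hconst, hs, ← Finset.sum_neg_distrib,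
      ← Finset.sum_add_distrib, ← Finset.sum_sub_distrib]
    refine Finset.sum_congr rfl fun j _ ↦ ?_
    rw [norm_sub_sq_real]
    ring
  rw [hexpand] at hj
  rw [inner_sub_right, inner_sub_right, real_inner_self_eq_norm_sq] at hopt
  change ‖m - f‖ ^ 2 ≤ ‖μ q - f‖ ^ 2 + T
  rw [norm_sub_sq_real, norm_sub_sq_real, real_inner_comm f m, real_inner_comm f (μ q)]
  linarith

end Deterministic

end AffineAggregation

namespace AffineAggregation

/-! ### Cardinality of the grid and choice of its size. -/

section Grid

/-- A grid point is determined by its multiplicities, natural numbers with sum `m`. Weighting each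
multiplicity vector by `z ^ m` bounds their number by the generating function `(∑ z ^ c) ^ M`. -/
lemma card_grid_mul_pow_le (M m : ℕ) {z : ℝ} (hz0 : 0 ≤ z) (hz1 : z < 1) :
    ((grid M m).card : ℝ) * z ^ m ≤ ((1 - z)⁻¹) ^ M := by
  classical
  set P : Finset (Fin M → ℕ) := Fintype.piFinset fun _ ↦ Finset.range (m + 1)
  set Q : Finset (Fin M → ℕ) := P.filter fun c ↦ ∑ j, c j = m with hQ
  have hsub : grid M m ⊆ Q.image fun c j ↦ (m : ℝ)⁻¹ * c j := by
    intro u hu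
    simp only [grid, Finset.mem_image, Finset.mem_univ, true_and] at hu
    obtain ⟨k, rfl⟩ := hu
    have hsum : ∑ j, (Finset.univ.filter fun q ↦ k q = j).card = m := by
      rw [← Finset.card_eq_sum_card_fiberwise (s := Finset.univ) (f := k) (by simp)]
      simp
    refine Finset.mem_image.2 ⟨fun j ↦ (Finset.univ.filter fun q ↦ k q = j).card, ?_, ?_⟩
    · refine Finset.mem_filter.2 ⟨Fintype.mem_piFinset.2 fun j ↦ ?_, hsum⟩
      rw [Finset.mem_range, Nat.lt_succ_iff]
      exact (Finset.card_le_univ _).trans (by simp)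
    · ext j
      simp [Finset.sum_apply, Pi.single_apply, eq_comm]
  have hcard : ((grid M m).card : ℝ) ≤ Q.card := by
    exact_mod_cast (Finset.card_le_card hsub).trans Finset.card_image_le
  calc ((grid M m).card : ℝ) * z ^ m ≤ Q.card * z ^ m := by gcongr
    _ = ∑ c ∈ Q, ∏ j, z ^ c j := by
        rw [Finset.sum_congr rfl (g := fun _ ↦ z ^ m), Finset.sum_const, nsmul_eq_mul]
        intro c hc
        rw [Finset.prod_pow_eq_pow_sum, (Finset.mem_filter.1 hc).2]
    _ ≤ ∑ c ∈ P, ∏ j, z ^ c j :=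
        Finset.sum_le_sum_of_subset_of_nonneg (Finset.filter_subset _ _) fun _ _ _ ↦
          Finset.prod_nonneg fun _ _ ↦ pow_nonneg hz0 _
    _ = ∏ _j : Fin M, ∑ c ∈ Finset.range (m + 1), z ^ c := by
        rw [Finset.prod_univ_sum]
    _ ≤ ∏ _j : Fin M, (1 - z)⁻¹ := by
        refine Finset.prod_le_prod (fun _ _ ↦ Finset.sum_nonneg fun _ _ ↦ pow_nonneg hz0 _)
          fun _ _ ↦ ?_
        rw [← tsum_geometric_of_lt_one hz0 hz1]
        exact (summable_geometric_of_lt_one hz0 hz1).sum_le_tsum _ fun _ _ ↦ pow_nonneg hz0 _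
    _ = _ := by simp

lemma grid_nonempty {M : ℕ} (hM : 1 ≤ M) (m : ℕ) : (grid M m).Nonempty :=
  Finset.Nonempty.image ⟨fun _ ↦ ⟨0, hM⟩, Finset.mem_univ _⟩ _

lemma mem_stdSimplex_of_mem_grid {M m : ℕ} (hm : 1 ≤ m) {u : Fin M → ℝ} (hu : u ∈ grid M m) :
    u ∈ stdSimplex ℝ (Fin M) := by
  simp only [grid, Finset.mem_image, Finset.mem_univ, true_and] at hu
  obtain ⟨k, rfl⟩ := hu
  rw [Finset.smul_sum]
  refine (convex_stdSimplex ℝ (Fin M)).sum_mem (fun _ _ ↦ by positivity) ?_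
    fun q _ ↦ single_mem_stdSimplex ℝ (k q)
  have : (m : ℝ) ≠ 0 := by positivity
  simp [this]

/-- With `l = log (1 + 1/r)`, the bound `1 + l + l²/2 ≤ exp l` yields `r l ≤ 1` and `r l² ≤ 2`.
Hence `(r l)² (1 + r) ≤ 3 r`, and `r / (1 + r) ≤ log (1 + r)`. -/
lemma sq_mul_log_one_add_inv_le {r : ℝ} (hr : 0 < r) :
    (r * Real.log (1 + r⁻¹)) ^ 2 ≤ 3 * Real.log (1 + r) := by
  set l := Real.log (1 + r⁻¹) with hl
  have hri : 0 < r⁻¹ := by positivity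
  have hl0 : 0 ≤ l := Real.log_nonneg (by linarith)
  have hexp : Real.exp l = 1 + r⁻¹ := Real.exp_log (by linarith)
  have h1 := Real.quadratic_le_exp_of_nonneg hl0
  rw [hexp] at h1
  have h2 : r * l ≤ 1 := by
    have : r * l ≤ r * r⁻¹ := by gcongr; nlinarith [sq_nonneg l]
    rwa [mul_inv_cancel₀ hr.ne'] at this
  have h3 : r * l ^ 2 ≤ 2 := by
    have : r * l ^ 2 ≤ r * (2 * r⁻¹) := by gcongr; linarith
    rwa [mul_left_comm, mul_inv_cancel₀ hr.ne', mul_one] at this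
  have h4 : r / (1 + r) ≤ Real.log (1 + r) := by
    have := Real.one_sub_inv_le_log_of_pos (show 0 < 1 + r by linarith)
    rwa [show 1 - (1 + r)⁻¹ = r / (1 + r) by field_simp; ring] at this
  refine le_trans ?_ (mul_le_mul_of_nonneg_left h4 (by norm_num))
  rw [← mul_div_assoc, le_div_iff₀ (by linarith)]
  have h5 : (r * l) ^ 2 ≤ 1 := pow_le_one₀ (by positivity) h2
  nlinarith

lemma gridSize_bounds {n M : ℕ} (hn : 1 ≤ n) (hM : 1 ≤ M)
    (h : (M : ℝ) ≤ √(n : ℝ) * (Real.exp n - 1)) :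
    1 ≤ gridSize n M ∧
    (gridSize n M : ℝ)⁻¹ ≤ 2 * √(Real.log (1 + M / √(n : ℝ)) / n) ∧
    Real.log (grid M (gridSize n M)).card ≤ 3 * (n * √(Real.log (1 + M / √(n : ℝ)) / n)) := by
  have hn0 : (0 : ℝ) < n := by exact_mod_cast hn
  have hM0 : (0 : ℝ) < M := by exact_mod_cast hM
  have hs : 0 < √(n : ℝ) := Real.sqrt_pos.2 hn0
  set r : ℝ := M / √(n : ℝ) with hr
  have hr0 : 0 < r := by positivity
  set L := Real.log (1 + r) with hL
  have hL0 : 0 < L := Real.log_pos (by linarith)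
  have hLn : L ≤ n := by
    rw [hL, Real.log_le_iff_le_exp (by linarith), hr, ← le_sub_iff_add_le', div_le_iff₀ hs]
    linarith
  set a := √(L / n) with ha
  have ha0 : 0 < a := by positivity
  have ha1 : a ≤ 1 := by
    rw [ha, Real.sqrt_le_one]; exact (div_le_one hn0).2 hLn
  have ha2 : L = n * a ^ 2 := by rw [ha, Real.sq_sqrt (by positivity)]; field_simp
  have hm : gridSize n M = ⌊a⁻¹⌋₊ := by
    rw [gridSize, ha, ← Real.sqrt_inv, inv_div]
  have hm1 : 1 ≤ gridSize n M := by
    rw [hm, Nat.one_le_floor_iff]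
    exact (one_le_inv₀ ha0).2 ha1
  set m := gridSize n M with hmdef
  have hm1' : (1 : ℝ) ≤ m := by exact_mod_cast hm1
  have hma : (m : ℝ) ≤ a⁻¹ := by rw [hm]; exact Nat.floor_le (by positivity)
  have hma' : a⁻¹ < m + 1 := by rw [hm]; exact Nat.lt_floor_add_one _
  refine ⟨hm1, ?_, ?_⟩
  · rw [inv_le_comm₀ (by linarith) (by positivity), mul_inv]
    linarith
  · have hz : (1 + r)⁻¹ < 1 := inv_lt_one_of_one_lt₀ (by linarith)
    -- This `z` gives `log card ≤ m L + M log (1 + 1/r)`; the two terms are at most `n a` and `2 n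
    -- a`.
    have hcard := card_grid_mul_pow_le M m (z := (1 + r)⁻¹) (by positivity) hz
    have hJ : (0 : ℝ) < (grid M m).card := by exact_mod_cast (grid_nonempty hM m).card_pos
    have hzi : (1 - (1 + r)⁻¹)⁻¹ = 1 + r⁻¹ := by
      have h1 : 1 - (1 + r)⁻¹ = r / (1 + r) := by
        rw [eq_div_iff (by linarith), sub_mul, inv_mul_cancel₀ (by linarith)]
        ring
      rw [h1, inv_div, add_div, div_self hr0.ne', one_div, add_comm]
    have hpow : 0 < (1 + r)⁻¹ ^ m := pow_pos (inv_pos.2 (by linarith)) m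
    have hlog := Real.log_le_log (mul_pos hJ hpow) hcard
    rw [Real.log_mul hJ.ne' hpow.ne', Real.log_pow, Real.log_pow, Real.log_inv, hzi, ← hL] at hlog
    have h1 : (m : ℝ) * L ≤ n * a := by
      calc (m : ℝ) * L ≤ a⁻¹ * L := by gcongr
        _ = n * a := by rw [ha2]; field_simp
    have h2 : M * Real.log (1 + r⁻¹) ≤ 2 * (n * a) := by
      have hMr : (M : ℝ) = √(n : ℝ) * r := by rw [hr]; field_simp
      refine abs_le_of_sq_le_sq' ?_ (by positivity) |>.2
      have h3 := sq_mul_log_one_add_inv_le hr0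
      calc (M * Real.log (1 + r⁻¹)) ^ 2 = √(n : ℝ) ^ 2 * (r * Real.log (1 + r⁻¹)) ^ 2 := by
            rw [hMr]; ring
        _ ≤ √(n : ℝ) ^ 2 * (3 * L) := by gcongr
        _ = 3 * (n * a) ^ 2 := by rw [Real.sq_sqrt hn0.le, ha2]; ring
        _ ≤ (2 * (n * a)) ^ 2 := by nlinarith [sq_nonneg ((n : ℝ) * a)]
    linarith

end Grid

/-! ### Approximation of convex combinations by averages. -/

section Maurey

variable {E : Type*} [NormedAddCommGroup E] [InnerProductSpace ℝ E] {ι : Type*} [Fintype ι]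

lemma exists_weighted_le {θ F : ι → ℝ} {c : ℝ} (hθ : θ ∈ stdSimplex ℝ ι)
    (h : ∑ j, θ j * F j ≤ c) : ∃ j, F j ≤ c := by
  by_contra! hc
  have hlt : ∑ j, θ j * c < ∑ j, θ j * F j := by
    have hne : ∃ j ∈ Finset.univ, θ j ≠ 0 := Finset.exists_ne_zero_of_sum_ne_zero
      (by rw [hθ.2]; exact one_ne_zero)
    obtain ⟨j, hj, hj0⟩ := hne
    exact Finset.sum_lt_sum (fun i _ ↦ mul_le_mul_of_nonneg_left (hc i).le (hθ.1 i))
      ⟨j, hj, mul_lt_mul_of_pos_left (hc j) ((hθ.1 j).lt_of_ne' hj0)⟩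
  rw [← Finset.sum_mul, hθ.2, one_mul] at hlt
  linarith

/-- Points are chosen one at a time: the `θ`-average of `‖a + w j‖²` has no cross term, so some `j`
adds at most `S`. This replaces sampling `m` independent indices. -/
lemma exists_norm_add_sum_sq_le {θ : ι → ℝ} (hθ : θ ∈ stdSimplex ℝ ι) {w : ι → E}
    (hw : ∑ j, θ j • w j = 0) {S : ℝ} (hS : ∑ j, θ j * ‖w j‖ ^ 2 ≤ S) (m : ℕ) (a : E) :
    ∃ k : Fin m → ι, ‖a + ∑ q, w (k q)‖ ^ 2 ≤ ‖a‖ ^ 2 + m * S := by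
  induction m generalizing a with
  | zero => exact ⟨Fin.elim0, by simp⟩
  | succ m ih =>
    obtain ⟨j, hj⟩ : ∃ j, ‖a + w j‖ ^ 2 ≤ ‖a‖ ^ 2 + S := by
      refine exists_weighted_le hθ ?_
      have hcross : ∑ j, θ j * inner ℝ a (w j) = 0 := by
        have := congrArg (inner ℝ a) hw
        simpa [inner_sum, inner_smul_right] using this
      calc ∑ j, θ j * ‖a + w j‖ ^ 2 = (∑ j, θ j) * ‖a‖ ^ 2 + 2 * ∑ j, θ j * inner ℝ a (w j)
            + ∑ j, θ j * ‖w j‖ ^ 2 := by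
            rw [Finset.sum_mul, Finset.mul_sum, ← Finset.sum_add_distrib,
              ← Finset.sum_add_distrib]
            refine Finset.sum_congr rfl fun j _ ↦ ?_
            rw [norm_add_sq_real]
            ring
        _ ≤ ‖a‖ ^ 2 + S := by rw [hθ.2, hcross]; linarith
    obtain ⟨k, hk⟩ := ih (a + w j)
    refine ⟨Fin.cons j k, ?_⟩
    rw [Fin.sum_univ_succ]
    simp only [Fin.cons_zero, Fin.cons_succ, ← add_assoc]
    push_cast
    linarith

/-- Maurey's argument: a convex combination is approximated by an average of `m` points. -/
lemma exists_average_norm_sub_sq_le {θ : ι → ℝ} (hθ : θ ∈ stdSimplex ℝ ι) (μ : ι → E) (g : E)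
    {S : ℝ} (hS : ∀ j, ‖μ j‖ ^ 2 ≤ S) {m : ℕ} (hm : 1 ≤ m) :
    ∃ k : Fin m → ι, ‖(m : ℝ)⁻¹ • ∑ q, μ (k q) - g‖ ^ 2 ≤
      ‖∑ j, θ j • μ j - g‖ ^ 2 + (m : ℝ)⁻¹ * S := by
  set c := ∑ j, θ j • μ j with hc
  have hm0 : (0 : ℝ) < m := by exact_mod_cast hm
  have hw : ∑ j, θ j • (μ j - c) = 0 := by
    simp only [smul_sub, Finset.sum_sub_distrib, ← Finset.sum_smul, hθ.2, one_smul, ← hc, sub_self]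
  have hvar : ∑ j, θ j * ‖μ j - c‖ ^ 2 ≤ S := by
    have hcross : ∑ j, θ j * inner ℝ (μ j) c = ‖c‖ ^ 2 := by
      rw [← real_inner_self_eq_norm_sq]
      conv_rhs => enter [2]; rw [hc]
      simp [sum_inner, inner_smul_left]
    have h1 : ∑ j, θ j * ‖μ j‖ ^ 2 ≤ S := by
      calc _ ≤ ∑ j, θ j * S :=
            Finset.sum_le_sum fun j _ ↦ mul_le_mul_of_nonneg_left (hS j) (hθ.1 j)
        _ = S := by rw [← Finset.sum_mul, hθ.2, one_mul]
    calc ∑ j, θ j * ‖μ j - c‖ ^ 2 = ∑ j, θ j * ‖μ j‖ ^ 2 - 2 * ∑ j, θ j * inner ℝ (μ j) c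
          + (∑ j, θ j) * ‖c‖ ^ 2 := by
          rw [Finset.sum_mul, Finset.mul_sum, ← Finset.sum_sub_distrib, ← Finset.sum_add_distrib]
          refine Finset.sum_congr rfl fun j _ ↦ ?_
          rw [norm_sub_sq_real]
          ring
      _ ≤ S := by rw [hcross, hθ.2]; linarith [sq_nonneg ‖c‖]
  -- Starting from `m (c - g)` puts the target `g` inside the norm, so the distances to `g` are
  -- compared directly, without a triangle inequality.
  obtain ⟨k, hk⟩ := exists_norm_add_sum_sq_le hθ hw hvar m ((m : ℝ) • (c - g))
  refine ⟨k, ?_⟩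
  have heq : (m : ℝ)⁻¹ • ∑ q, μ (k q) - g =
      (m : ℝ)⁻¹ • ((m : ℝ) • (c - g) + ∑ q, (μ (k q) - c)) := by
    rw [Finset.sum_sub_distrib, Finset.sum_const, Finset.card_univ, Fintype.card_fin,
      ← Nat.cast_smul_eq_nsmul ℝ, ← sub_eq_zero]
    match_scalars <;> field_simp <;> ring
  rw [heq, norm_smul, mul_pow, Real.norm_eq_abs, sq_abs]
  calc _ ≤ ((m : ℝ)⁻¹) ^ 2 * (‖(m : ℝ) • (c - g)‖ ^ 2 + m * S) := by gcongr
    _ = _ := by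
      rw [norm_smul, mul_pow, Real.norm_eq_abs, sq_abs]
      field_simp

end Maurey

/-! ### Transfer from the standard Gaussian to the law of the noise. -/

section Law

variable {n : ℕ}

lemma multivariateGaussian_smul_one (σ : ℝ) :
    multivariateGaussian 0 (σ ^ 2 • (1 : Matrix (Fin n) (Fin n) ℝ)) =
      (stdGaussian (EuclideanSpace ℝ (Fin n))).map fun z ↦ σ • z := by
  have hps : (σ ^ 2 • (1 : Matrix (Fin n) (Fin n) ℝ)).PosSemidef :=
    Matrix.PosSemidef.one.smul (sq_nonneg σ)
  refine Measure.ext_of_charFun ?_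
  ext t
  rw [charFun_multivariateGaussian hps, charFun_map_smul, charFun_stdGaussian]
  congr 1
  rw [norm_smul, ← Complex.ofReal_pow, mul_pow, EuclideanSpace.real_norm_sq_eq]
  simp [Matrix.smul_mulVec, dotProduct, pow_two, Finset.mul_sum]
  simp only [← neg_div]
  congr 2
  exact Finset.sum_congr rfl fun i _ ↦ by ring

/-- The exceptional event lives in the noise space, where it is measurable. The event `G` need not
be: only monotonicity of `P` is applied to it. -/
lemma one_sub_lt_measureReal_of_noise {Ω : Type*} [MeasurableSpace Ω] {P : Measure Ω}
    [IsProbabilityMeasure P] {σ δ : ℝ} {ξ : Ω → EuclideanSpace ℝ (Fin n)}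
    (hξ : HasLaw ξ (multivariateGaussian 0 (σ ^ 2 • (1 : Matrix (Fin n) (Fin n) ℝ))) P)
    {S : Set (EuclideanSpace ℝ (Fin n))} (hS : MeasurableSet S)
    (hδ : (stdGaussian (EuclideanSpace ℝ (Fin n))).real {z | σ • z ∈ S} < δ) {G : Set Ω}
    (hG : ∀ ω, ξ ω ∉ S → ω ∈ G) : 1 - δ < P.real G := by
  have h1 : P.real {ω | ξ ω ∈ Sᶜ} =
      1 - (stdGaussian (EuclideanSpace ℝ (Fin n))).real {z | σ • z ∈ S} := by
    rw [hξ.measureReal_eq (p := (· ∈ Sᶜ)) hS.compl, multivariateGaussian_smul_one]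
    change ((stdGaussian (EuclideanSpace ℝ (Fin n))).map fun z ↦ σ • z).real Sᶜ = _
    rw [map_measureReal_apply (by fun_prop) hS.compl]
    exact probReal_compl_eq_one_sub (hS.preimage (by fun_prop))
  have h2 : P.real {ω | ξ ω ∈ Sᶜ} ≤ P.real G := measureReal_mono fun ω hω ↦ hG ω hω
  linarith

end Law

end AffineAggregation

namespace AffineAggregation

/-! ### Oracle inequalities for the two criteria. -/

section Oracle

variable {n : ℕ} {ι : Type*} [Fintype ι]

lemma trace_toEuclideanCLM (A : Matrix (Fin n) (Fin n) ℝ) :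
    LinearMap.trace ℝ (EuclideanSpace ℝ (Fin n))
      (Matrix.toEuclideanCLM (𝕜 := ℝ) A : EuclideanSpace ℝ (Fin n) →ₗ[ℝ] _) = A.trace := by
  rw [LinearMap.trace_eq_sum_inner _ (EuclideanSpace.basisFun (Fin n) ℝ), Matrix.trace]
  refine Finset.sum_congr rfl fun i _ ↦ ?_
  simp [Matrix.inner_toEuclideanCLM]

lemma affineEst_sub_affineEst (A A' : Matrix (Fin n) (Fin n) ℝ)
    (b b' f ξ : EuclideanSpace ℝ (Fin n)) :
    affineEst A b (f + ξ) - affineEst A' b' (f + ξ) =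
      (Matrix.toEuclideanCLM (𝕜 := ℝ) (A - A') f + (b - b'))
        + Matrix.toEuclideanCLM (𝕜 := ℝ) (A - A') ξ := by
  simp only [affineEst, map_add, map_sub, sub_apply]
  abel

lemma noiseTerm_sub_noiseTerm (σ : ℝ) (A A' : Matrix (Fin n) (Fin n) ℝ)
    (b b' f ξ : EuclideanSpace ℝ (Fin n)) :
    noiseTerm σ A b f ξ - noiseTerm σ A' b' f ξ =
      2 * (inner ℝ ξ ((Matrix.toEuclideanCLM (𝕜 := ℝ) (A - A') f + (b - b'))
        + Matrix.toEuclideanCLM (𝕜 := ℝ) (A - A') ξ)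
        - σ ^ 2 * LinearMap.trace ℝ (EuclideanSpace ℝ (Fin n))
          (Matrix.toEuclideanCLM (𝕜 := ℝ) (A - A') : EuclideanSpace ℝ (Fin n) →ₗ[ℝ] _)) := by
  rw [trace_toEuclideanCLM, ← affineEst_sub_affineEst, Matrix.trace_sub, inner_sub_right]
  simp only [noiseTerm]
  ring

lemma norm_toEuclideanCLM_sub_le {A A' : Matrix (Fin n) (Fin n) ℝ} (hA : ‖A‖ ≤ 1)
    (hA' : ‖A'‖ ≤ 1) : ‖Matrix.toEuclideanCLM (𝕜 := ℝ) (A - A')‖ ≤ 2 := by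
  rw [Matrix.l2_opNorm_toEuclideanCLM]
  linarith [norm_sub_le A A']

lemma norm_le_mul_sqrt {R : ℝ} (hn : 1 ≤ n) (hR : 0 < R) {v : EuclideanSpace ℝ (Fin n)}
    (h : 1 / (n : ℝ) * ‖v‖ ^ 2 ≤ R ^ 2) : ‖v‖ ≤ R * √(n : ℝ) := by
  have hn0 : (0 : ℝ) < n := by exact_mod_cast hn
  refine abs_le_of_sq_le_sq' ?_ (by positivity) |>.2
  rw [mul_pow, Real.sq_sqrt hn0.le]
  rw [one_div, inv_mul_le_iff₀ hn0] at h
  linarith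

@[fun_prop]
lemma continuous_affineEst (A : Matrix (Fin n) (Fin n) ℝ) (b : EuclideanSpace ℝ (Fin n)) :
    Continuous (affineEst A b) := by
  unfold affineEst
  fun_prop

@[fun_prop]
lemma continuous_noiseTerm (σ : ℝ) (A : Matrix (Fin n) (Fin n) ℝ)
    (b f : EuclideanSpace ℝ (Fin n)) : Continuous (noiseTerm σ A b f) := by
  have := continuous_affineEst A b
  unfold noiseTerm
  fun_prop

/-- The oracle inequality for the minimizer of Mallows' criterion over the simplex. -/
theorem Cp_oracle {Ω : Type*} [MeasurableSpace Ω] {P : Measure Ω} [IsProbabilityMeasure P]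
    [Nonempty ι] (hn : 1 ≤ n) {σ R : ℝ} (hσ : 0 ≤ σ) (hR : 0 < R)
    {f : EuclideanSpace ℝ (Fin n)} {A : ι → Matrix (Fin n) (Fin n) ℝ}
    {b : ι → EuclideanSpace ℝ (Fin n)} {ξ : Ω → EuclideanSpace ℝ (Fin n)}
    (hξ : HasLaw ξ (multivariateGaussian 0 (σ ^ 2 • (1 : Matrix (Fin n) (Fin n) ℝ))) P)
    (hf : 1 / (n : ℝ) * ‖f‖ ^ 2 ≤ R ^ 2) (hb : ∀ j, 1 / (n : ℝ) * ‖b j‖ ^ 2 ≤ R ^ 2)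
    (hA : ∀ j, ‖A j‖ ≤ 1) {θC : Ω → ι → ℝ}
    (hθ : ∀ ω, IsSimplexArgmin (Cp σ A b (f + ξ ω)) (θC ω)) {x : ℝ} (hx : 0 < x) :
    1 - 2 * Real.exp (-x) < P.real {ω | ∀ θ ∈ stdSimplex ℝ ι,
      1 / (n : ℝ) * ‖mixEst A b (f + ξ ω) (θC ω) - f‖ ^ 2 ≤
        1 / (n : ℝ) * ‖mixEst A b (f + ξ ω) θ - f‖ ^ 2
          + 8 * (σ ^ 2 + σ * R * √2) * √((x + 2 * Real.log (Fintype.card ι)) / n)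
          + 8 * σ ^ 2 * (x + 2 * Real.log (Fintype.card ι)) / n} := by
  have hn0 : (0 : ℝ) < n := by exact_mod_cast hn
  set X := x + 2 * Real.log (Fintype.card ι) with hX
  have hX0 : 0 < X := by
    have : 0 ≤ Real.log (Fintype.card ι) := Real.log_natCast_nonneg _
    linarith
  set T : ℝ := n * (8 * (σ ^ 2 + σ * R * √2) * √(X / n) + 8 * σ ^ 2 * X / n) with hT
  have hT0 : 0 ≤ T := by positivity
  set S : ι → ι → Set (EuclideanSpace ℝ (Fin n)) := fun j k ↦
    {ζ | T < noiseTerm σ (A j) (b j) f ζ - noiseTerm σ (A k) (b k) f ζ} with hS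
  have hSo : ∀ j k, IsOpen (S j k) := fun j k ↦
    isOpen_lt continuous_const
      ((continuous_noiseTerm σ (A j) (b j) f).sub (continuous_noiseTerm σ (A k) (b k) f))
  have hopen : IsOpen {ζ | ∃ j k, j ≠ k ∧ ζ ∈ S j k} := by
    simp only [Set.ofPred_exists, Set.ofPred_and]
    exact isOpen_iUnion fun j ↦ isOpen_iUnion fun k ↦ isOpen_const.inter (hSo j k)
  refine one_sub_lt_measureReal_of_noise hξ hopen.measurableSet ?_ fun ω hω θ hθs ↦ ?_
  · suffices h : (stdGaussian (EuclideanSpace ℝ (Fin n))).real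
        {z | ∃ j k, j ≠ k ∧ z ∈ {z | σ • z ∈ S j k}} < 2 * Real.exp (-x) from h
    refine measureReal_offDiag_union_lt _ two_pos (fun j k ↦ {z | σ • z ∈ S j k})
      fun j k _ ↦ ?_
    have hv : ‖Matrix.toEuclideanCLM (𝕜 := ℝ) (A j - A k) f + (b j - b k)‖ ≤
        4 * R * √(n : ℝ) := by
      have h1 := (Matrix.toEuclideanCLM (𝕜 := ℝ) (A j - A k)).le_of_opNorm_le
        (norm_toEuclideanCLM_sub_le (hA j) (hA k)) f
      have h2 := norm_add_le (Matrix.toEuclideanCLM (𝕜 := ℝ) (A j - A k) f) (b j - b k)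
      linarith [norm_sub_le (b j) (b k), norm_le_mul_sqrt hn hR hf, norm_le_mul_sqrt hn hR (hb j),
        norm_le_mul_sqrt hn hR (hb k)]
    have h := cp_increment_tail _ _ (by simp) hn0 hR hσ hX0
      (norm_toEuclideanCLM_sub_le (hA j) (hA k)) hv
    simp only [hS, Set.mem_ofPred_eq, noiseTerm_sub_noiseTerm]
    exact h
  · have h := Cp_argmin_risk_le (hθ ω) hθs hT0 fun j k hjk ↦ by
      by_contra! hcon
      exact hω ⟨j, k, hjk, hcon⟩
    have h2 := mul_le_mul_of_nonneg_left h (one_div_nonneg.2 hn0.le)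
    rw [mul_add, hT, one_div, inv_mul_cancel_left₀ hn0.ne'] at h2
    rw [one_div]
    linarith

/-- The oracle inequality for the minimizer of the penalized criterion over a simplex, together
with a bound on the noise. -/
theorem Hpen_oracle {Ω : Type*} [MeasurableSpace Ω] {P : Measure Ω} [IsProbabilityMeasure P]
    [Nonempty ι] {σ : ℝ} (hσ : 0 ≤ σ)
    {f : EuclideanSpace ℝ (Fin n)} {A : ι → Matrix (Fin n) (Fin n) ℝ}
    {b : ι → EuclideanSpace ℝ (Fin n)} {ξ : Ω → EuclideanSpace ℝ (Fin n)}
    (hξ : HasLaw ξ (multivariateGaussian 0 (σ ^ 2 • (1 : Matrix (Fin n) (Fin n) ℝ))) P)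
    (hA : ∀ j, ‖A j‖ ≤ 1) {θpen : Ω → ι → ℝ}
    (hθ : ∀ ω, IsSimplexArgmin (Hpen σ A b (f + ξ ω)) (θpen ω)) {x : ℝ} (hx : 0 < x) :
    1 - 3 * Real.exp (-x) < P.real {ω | (∀ q,
      ‖mixEst A b (f + ξ ω) (θpen ω) - f‖ ^ 2 ≤ ‖affineEst (A q) (b q) (f + ξ ω) - f‖ ^ 2
        + 46 * σ ^ 2 * (x + 2 * Real.log (Fintype.card ι))) ∧
      ‖ξ ω‖ ^ 2 ≤ σ ^ 2 * (2 * n + 3 * x)} := by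
  set X := x + 2 * Real.log (Fintype.card ι) with hX
  have hX0 : 0 < X := by
    have : 0 ≤ Real.log (Fintype.card ι) := Real.log_natCast_nonneg _
    linarith
  set T : ℝ := 46 * σ ^ 2 * X with hT
  have hT0 : 0 ≤ T := by positivity
  set S : ι → ι → Set (EuclideanSpace ℝ (Fin n)) := fun j k ↦
    {ζ | T < noiseTerm σ (A j) (b j) f ζ - noiseTerm σ (A k) (b k) f ζ
      - 1 / 2 * ‖affineEst (A j) (b j) (f + ζ) - affineEst (A k) (b k) (f + ζ)‖ ^ 2} with hS
  have hSo : ∀ j k, IsOpen (S j k) := fun j k ↦ by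
    have hj := continuous_affineEst (A j) (b j)
    have hk := continuous_affineEst (A k) (b k)
    have hj' := continuous_noiseTerm σ (A j) (b j) f
    have hk' := continuous_noiseTerm σ (A k) (b k) f
    exact isOpen_lt continuous_const (by fun_prop)
  have hopen : IsOpen {ζ | ∃ j k, j ≠ k ∧ ζ ∈ S j k} := by
    simp only [Set.ofPred_exists, Set.ofPred_and]
    exact isOpen_iUnion fun j ↦ isOpen_iUnion fun k ↦ isOpen_const.inter (hSo j k)
  have hopen' : IsOpen {ζ : EuclideanSpace ℝ (Fin n) | σ ^ 2 * (2 * n + 3 * x) < ‖ζ‖ ^ 2} :=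
    isOpen_lt (by fun_prop) (by fun_prop)
  refine one_sub_lt_measureReal_of_noise hξ (hopen.union hopen').measurableSet ?_
    fun ω hω ↦ ?_
  · have h1 : (stdGaussian (EuclideanSpace ℝ (Fin n))).real
        {z | ∃ j k, j ≠ k ∧ z ∈ {z | σ • z ∈ S j k}} < 2 * Real.exp (-x) := by
      refine measureReal_offDiag_union_lt _ two_pos (fun j k ↦ {z | σ • z ∈ S j k})
        fun j k _ ↦ ?_
      have h := hpen_increment_tail (Matrix.toEuclideanCLM (𝕜 := ℝ) (A j - A k))
        (Matrix.toEuclideanCLM (𝕜 := ℝ) (A j - A k) f + (b j - b k)) (x := X) hσ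
        (norm_toEuclideanCLM_sub_le (hA j) (hA k))
      simp only [hS, Set.mem_ofPred_eq, noiseTerm_sub_noiseTerm, affineEst_sub_affineEst]
      exact h
    have h2 := noise_norm_tail (E := EuclideanSpace ℝ (Fin n)) σ x
    rw [finrank_euclideanSpace_fin] at h2
    refine (measureReal_union_le _ _).trans_lt ((add_lt_add_of_lt_of_le h1 h2).trans_eq ?_)
    ring
  · simp only [Set.mem_union, not_or] at hω
    refine ⟨fun q ↦ Hpen_argmin_risk_le (hθ ω) hT0 q fun j hj ↦ ?_, not_lt.1 hω.2⟩
    by_contra! hcon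
    exact hω.1 ⟨j, q, hj, hcon⟩

end Oracle

/-! ### Aggregation over the grid. -/

section GridAggregate

variable {n M : ℕ}

lemma norm_mixMatrix_le_one {A : Fin M → Matrix (Fin n) (Fin n) ℝ} (hA : ∀ j, ‖A j‖ ≤ 1)
    {θ : Fin M → ℝ} (hθ : θ ∈ stdSimplex ℝ (Fin M)) : ‖mixMatrix A θ‖ ≤ 1 := by
  have h := (convex_closedBall (0 : Matrix (Fin n) (Fin n) ℝ) 1).sum_mem
    (t := Finset.univ) (w := θ) (z := A) (fun j _ ↦ hθ.1 j) hθ.2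
    fun j _ ↦ mem_closedBall_zero_iff.2 (hA j)
  exact mem_closedBall_zero_iff.1 h

lemma norm_affineEst_sq_le {R σ x : ℝ} (hn : 1 ≤ n) (hR : 0 < R)
    {A : Matrix (Fin n) (Fin n) ℝ} {b f ξ : EuclideanSpace ℝ (Fin n)} (hA : ‖A‖ ≤ 1)
    (hf : 1 / (n : ℝ) * ‖f‖ ^ 2 ≤ R ^ 2) (hb : 1 / (n : ℝ) * ‖b‖ ^ 2 ≤ R ^ 2)
    (hξ : ‖ξ‖ ^ 2 ≤ σ ^ 2 * (2 * n + 3 * x)) :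
    ‖affineEst A b (f + ξ)‖ ^ 2 ≤ 8 * R ^ 2 * n + 2 * (σ ^ 2 * (2 * n + 3 * x)) := by
  have h1 : ‖affineEst A b (f + ξ)‖ ≤ 2 * (R * √(n : ℝ)) + ‖ξ‖ := by
    have h2 : ‖Matrix.toEuclideanCLM (𝕜 := ℝ) A (f + ξ)‖ ≤ 1 * ‖f + ξ‖ :=
      ContinuousLinearMap.le_of_opNorm_le _ hA (f + ξ)
    have h3 : ‖affineEst A b (f + ξ)‖ ≤ _ := norm_add_le _ _
    linarith [norm_add_le f ξ, norm_le_mul_sqrt hn hR hf, norm_le_mul_sqrt hn hR hb]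
  have h4 := pow_le_pow_left₀ (norm_nonneg _) h1 2
  have h5 : (R * √(n : ℝ)) ^ 2 = R ^ 2 * n := by rw [mul_pow, Real.sq_sqrt (by positivity)]
  nlinarith [sq_nonneg (2 * (R * √(n : ℝ)) - ‖ξ‖)]

lemma sum_average_single_smul {E : Type*} [AddCommGroup E] [Module ℝ E] {m : ℕ}
    (k : Fin m → Fin M) (v : Fin M → E) :
    ∑ j, ((m : ℝ)⁻¹ • ∑ q, Pi.single (M := fun _ ↦ ℝ) (k q) (1 : ℝ)) j • v j =
      (m : ℝ)⁻¹ • ∑ q, v (k q) := by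
  simp only [Pi.smul_apply, Finset.sum_apply, smul_eq_mul, mul_smul, ← Finset.smul_sum,
    Finset.sum_smul]
  rw [Finset.sum_comm]
  simp [Pi.single_apply]

lemma exists_grid_affineEst_le {m : ℕ} (hm : 1 ≤ m) {A : Fin M → Matrix (Fin n) (Fin n) ℝ}
    {b : Fin M → EuclideanSpace ℝ (Fin n)} {f y : EuclideanSpace ℝ (Fin n)} {S : ℝ}
    (hS : ∀ j, ‖affineEst (A j) (b j) y‖ ^ 2 ≤ S) {θ : Fin M → ℝ}
    (hθ : θ ∈ stdSimplex ℝ (Fin M)) :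
    ∃ u : grid M m, ‖affineEst (gridMatrix m A u) (gridVector m b u) y - f‖ ^ 2 ≤
      ‖mixEst A b y θ - f‖ ^ 2 + (m : ℝ)⁻¹ * S := by
  obtain ⟨k, hk⟩ := exists_average_norm_sub_sq_le hθ (fun j ↦ affineEst (A j) (b j) y) f hS hm
  have hmem : (m : ℝ)⁻¹ • ∑ q, Pi.single (k q) (1 : ℝ) ∈ grid M m :=
    Finset.mem_image_of_mem _ (Finset.mem_univ k)
  refine ⟨⟨_, hmem⟩, ?_⟩
  have h : affineEst (gridMatrix m A ⟨_, hmem⟩) (gridVector m b ⟨_, hmem⟩) y =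
      (m : ℝ)⁻¹ • ∑ q, affineEst (A (k q)) (b (k q)) y :=
    (mixEst_eq_sum A b y _).trans
      (sum_average_single_smul k fun j ↦ affineEst (A j) (b j) y)
  rw [h, mixEst_eq_sum A b y θ]
  exact hk

/-- The oracle inequality over the simplex for the penalized procedure on the grid. -/
theorem grid_oracle {Ω : Type*} [MeasurableSpace Ω] {P : Measure Ω} [IsProbabilityMeasure P]
    (hn : 1 ≤ n) (hM : 1 ≤ M) {σ R : ℝ} (hσ : 0 ≤ σ) (hR : 0 < R)
    {f : EuclideanSpace ℝ (Fin n)} {A : Fin M → Matrix (Fin n) (Fin n) ℝ}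
    {b : Fin M → EuclideanSpace ℝ (Fin n)} {ξ : Ω → EuclideanSpace ℝ (Fin n)}
    (hξ : HasLaw ξ (multivariateGaussian 0 (σ ^ 2 • (1 : Matrix (Fin n) (Fin n) ℝ))) P)
    (hf : 1 / (n : ℝ) * ‖f‖ ^ 2 ≤ R ^ 2) (hb : ∀ j, 1 / (n : ℝ) * ‖b j‖ ^ 2 ≤ R ^ 2)
    (hA : ∀ j, ‖A j‖ ≤ 1) (hMn : (M : ℝ) ≤ √(n : ℝ) * (Real.exp n - 1))
    {θpen : Ω → grid M (gridSize n M) → ℝ}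
    (hθ : ∀ ω, IsSimplexArgmin (Hpen σ (gridMatrix (gridSize n M) A)
      (gridVector (gridSize n M) b) (f + ξ ω)) (θpen ω)) {x : ℝ} (hx : 0 < x) :
    1 - 3 * Real.exp (-x) < P.real {ω | ∀ θ ∈ stdSimplex ℝ (Fin M),
      1 / (n : ℝ) * ‖mixEst (gridMatrix (gridSize n M) A) (gridVector (gridSize n M) b)
          (f + ξ ω) (θpen ω) - f‖ ^ 2 ≤
        1 / (n : ℝ) * ‖mixEst A b (f + ξ ω) θ - f‖ ^ 2
          + 300 * max (R ^ 2) (σ ^ 2) * √(Real.log (1 + M / √(n : ℝ)) / n)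
          + 300 * σ ^ 2 * x / n} := by
  have hn0 : (0 : ℝ) < n := by exact_mod_cast hn
  obtain ⟨hm, hminv, hcard⟩ := gridSize_bounds hn hM hMn
  have : Nonempty (grid M (gridSize n M)) := (grid_nonempty hM _).to_subtype
  refine (Hpen_oracle (A := gridMatrix (gridSize n M) A) (b := gridVector (gridSize n M) b) hσ hξ
    (fun u ↦ norm_mixMatrix_le_one hA (mem_stdSimplex_of_mem_grid hm u.2)) hθ hx).trans_le
    (measureReal_mono fun ω hω θ hθs ↦ ?_)
  obtain ⟨hω1, hω2⟩ := hω
  obtain ⟨u, hu⟩ := exists_grid_affineEst_le (f := f) hm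
    (fun j ↦ norm_affineEst_sq_le hn hR (hA j) hf (hb j) hω2) hθs
  have h1 := hω1 u
  rw [Fintype.card_coe] at h1
  set a := √(Real.log (1 + M / √(n : ℝ)) / n) with ha
  set V := max (R ^ 2) (σ ^ 2) with hV
  have hRV : R ^ 2 ≤ V := le_max_left _ _
  have hσV : σ ^ 2 ≤ V := le_max_right _ _
  have hV0 : 0 ≤ V := (sq_nonneg _).trans hRV
  have ha0 : 0 ≤ a := Real.sqrt_nonneg _
  have hm1 : (gridSize n M : ℝ)⁻¹ ≤ 1 := inv_le_one_of_one_le₀ (by exact_mod_cast hm)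
  have hm0 : 0 ≤ (gridSize n M : ℝ)⁻¹ := by positivity
  have hx' : 0 ≤ σ ^ 2 * x := by positivity
  -- The coefficient of `V n a` is `92 * 3 = 276` from the cardinality plus `24` from the
  -- approximation error, hence `300`. That of `σ² x` is `46 + 6`.
  have b1 : σ ^ 2 * Real.log (grid M (gridSize n M)).card ≤ V * (3 * (n * a)) :=
    mul_le_mul hσV hcard (Real.log_natCast_nonneg _) hV0
  have b2 : (gridSize n M : ℝ)⁻¹ * (8 * R ^ 2 * n + 4 * σ ^ 2 * n) ≤ 2 * a * (12 * V * n) := by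
    refine mul_le_mul hminv ?_ (by positivity) (by positivity)
    nlinarith
  have b3 : (gridSize n M : ℝ)⁻¹ * (6 * (σ ^ 2 * x)) ≤ 1 * (6 * (σ ^ 2 * x)) := by gcongr
  have key : ‖mixEst (gridMatrix (gridSize n M) A) (gridVector (gridSize n M) b)
      (f + ξ ω) (θpen ω) - f‖ ^ 2 ≤
      ‖mixEst A b (f + ξ ω) θ - f‖ ^ 2 + n * (300 * V * a + 300 * σ ^ 2 * x / n) := by
    have e : n * (300 * V * a + 300 * σ ^ 2 * x / n) = 300 * (V * (n * a)) + 300 * (σ ^ 2 * x) := by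
      field_simp
    rw [e]
    linarith
  have h2 := mul_le_mul_of_nonneg_left key (one_div_nonneg.2 hn0.le)
  rw [mul_add, one_div, inv_mul_cancel_left₀ hn0.ne'] at h2
  rw [one_div]
  linarith

end GridAggregate

end AffineAggregation

theorem mainTheorem7 :
    ∃ C : ℝ, 0 < C ∧
      ∀ {Ω : Type*} [MeasurableSpace Ω] (P : Measure Ω) [IsProbabilityMeasure P]
        (n M : ℕ) (_hn : 1 ≤ n) (_hM : 1 ≤ M) (σ R : ℝ) (_hσ : 0 ≤ σ) (_hR : 0 < R)
        (f : EuclideanSpace ℝ (Fin n))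
        (A : Fin M → Matrix (Fin n) (Fin n) ℝ) (b : Fin M → EuclideanSpace ℝ (Fin n))
        (ξ : Ω → EuclideanSpace ℝ (Fin n))
        (_hξ : HasLaw ξ
          (multivariateGaussian 0 (σ ^ 2 • (1 : Matrix (Fin n) (Fin n) ℝ))) P)
        (_hf : 1 / (n : ℝ) * ‖f‖ ^ 2 ≤ R ^ 2)
        (_hb : ∀ j, 1 / (n : ℝ) * ‖b j‖ ^ 2 ≤ R ^ 2)
        (_hA : ∀ j, ‖A j‖ ≤ 1),
        -- the minimizer of `C_p` over the simplex
        (∀ θC : Ω → Fin M → ℝ,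
          (∀ ω, AffineAggregation.IsSimplexArgmin
            (AffineAggregation.Cp σ A b (f + ξ ω)) (θC ω)) →
          ∀ x : ℝ, 0 < x →
            1 - 2 * Real.exp (-x) <
              P.real {ω | ∀ θ ∈ stdSimplex ℝ (Fin M),
                1 / (n : ℝ) * ‖AffineAggregation.mixEst A b (f + ξ ω) (θC ω) - f‖ ^ 2 ≤
                  1 / (n : ℝ) * ‖AffineAggregation.mixEst A b (f + ξ ω) θ - f‖ ^ 2
                    + 8 * (σ ^ 2 + σ * R * √2) * √((x + 2 * Real.log M) / n)
                    + 8 * σ ^ 2 * (x + 2 * Real.log M) / n}) ∧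
        -- the penalized procedure applied to the estimators indexed by the grid
        ((M : ℝ) ≤ √(n : ℝ) * (Real.exp n - 1) →
          ∀ θpen : Ω → AffineAggregation.grid M (AffineAggregation.gridSize n M) → ℝ,
          (∀ ω, AffineAggregation.IsSimplexArgmin
            (AffineAggregation.Hpen σ
              (AffineAggregation.gridMatrix (AffineAggregation.gridSize n M) A)
              (AffineAggregation.gridVector (AffineAggregation.gridSize n M) b)
              (f + ξ ω)) (θpen ω)) →
          ∀ x : ℝ, 0 < x →
            1 - 3 * Real.exp (-x) <
              P.real {ω | ∀ θ ∈ stdSimplex ℝ (Fin M),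
                1 / (n : ℝ) *
                  ‖AffineAggregation.mixEst
                    (AffineAggregation.gridMatrix (AffineAggregation.gridSize n M) A)
                    (AffineAggregation.gridVector (AffineAggregation.gridSize n M) b)
                    (f + ξ ω) (θpen ω) - f‖ ^ 2 ≤
                  1 / (n : ℝ) * ‖AffineAggregation.mixEst A b (f + ξ ω) θ - f‖ ^ 2
                    + C * max (R ^ 2) (σ ^ 2) * √(Real.log (1 + M / √(n : ℝ)) / n)
                    + C * σ ^ 2 * x / n}) := by

  refine ⟨300, by norm_num, ?_⟩
  intro Ω _ P _ n M hn hM σ R hσ hR f A b ξ hξ hf hb hA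
  refine ⟨fun θC hθ x hx ↦ ?_, fun hMn θpen hθ x hx ↦
    AffineAggregation.grid_oracle hn hM hσ hR hξ hf hb hA hMn hθ hx⟩
  have : Nonempty (Fin M) := ⟨⟨0, hM⟩⟩
  have h := AffineAggregation.Cp_oracle hn hσ hR hξ hf hb hA hθ hx
  rwa [Fintype.card_fin] at h
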